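/- \textbf{Theorem.} Setting. For $d\ge 0$ let $\mathcal A=\{a\in\mathbb R^{d+1}:\|a\|\le 1\}$ (Euclidean norm). In the linear bandit instance with parameter $\theta\in\mathbb R^{d+1}\setminus\{0\}$, in each round $t=1,\dots,T$ the learner plays $a_t\in\mathcal A$ and observes $y_t=\langle a_t,\theta\rangle+\xi_t$, where the $\xi_t$ are i.i.d. standard Gaussian. A learning algorithm is a (possibly randomised) measurable rule that chooses $a_t$ from $y_1,\dots,y_{t-1}$, its past actions and internal randomness independent of the noise. Put $a^\star_\theta=\theta/\|\theta\|$ and $$\operatorname{Reg}^\theta(T)=\sum_{t=1}^T\langle\theta,a^\star_\theta-a_t\rangle,\qquad \operatorname{Reg}^\theta_h(T)=\sum_{t=1}^T\langle\theta,h-a_t\rangle .$$ Claim. There are absolute constants $0<r_1\le r_2$ and $c>0$ such that the following holds for every $d\ge 0$, every horizon $T\ge 1$, every hint $h\in\mathbb R^{d+1}$ with $\|h\|=1$ and every learning algorithm. There is a finite nonempty family $\Theta\subset\mathbb R^{d+1}$ of parameters with $r_1\le\|\theta\|\le r_2$ for all $\theta\in\Theta$ such that $R_h:=\max_{\theta\in\Theta}\mathbb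 E[\operatorname{Reg}^\theta_h(T)]$ satisfies $R_h\ge 0$, and such that some $\theta\in\Theta$ satisfies $$\mathbb E[\operatorname{Reg}^\theta(T)]\ \ge\ \frac14+\frac T4\,\min\Bigl(1,\frac{d-1}{R_h}\Bigr),$$ where the minimum is read as $1$ if $R_h=0$; moreover, for the same $\theta$, if $R_h\ge d$ (and $R_h>0$) then $$\mathbb E[\operatorname{Reg}^\theta(T)]\ \ge\ c\,\frac{dT}{R_h},\qquad\text{that is,}\qquad R_h\cdot\mathbb E[\operatorname{Reg}^\theta(T)]\ \ge\ c\,dT .$$ -/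

import Mathlib

open MeasureTheory ProbabilityTheory

namespace HintBandit

/-- A (possibly randomised) learning algorithm for the unit ball of `ℝᵐ`. A random seed in `Ω` is
drawn once; in round `t` (rounds are numbered `0, 1, 2, …`) the action is a measurable function of
the seed and of the `t` rewards seen so far. (Past actions are functions of the same data.) -/
structure Algorithm (m : ℕ) (Ω : Type*) [MeasurableSpace Ω] where
  seedLaw : Measure Ω
  isProbabilityMeasure_seedLaw : IsProbabilityMeasure seedLaw
  action : (t : ℕ) → Ω → (Fin t → ℝ) → EuclideanSpace ℝ (Fin m)
  measurable_action : ∀ t, Measurable (fun p : Ω × (Fin t → ℝ) => action t p.1 p.2)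
  norm_action_le : ∀ t ω y, ‖action t ω y‖ ≤ 1

attribute [instance] Algorithm.isProbabilityMeasure_seedLaw

variable {m : ℕ} {Ω : Type*} [MeasurableSpace Ω]

/-- Appends to the seed and the first `t` rewards the reward of round `t`, which is
`⟪a_t, θ⟫ + ξ` where `a_t` is the action played and `ξ` is the noise. -/
noncomputable def step (alg : Algorithm m Ω) (θ : EuclideanSpace ℝ (Fin m)) (t : ℕ)
    (p : (Ω × (Fin t → ℝ)) × ℝ) : Ω × (Fin (t + 1) → ℝ) :=
  (p.1.1, Fin.snoc p.1.2 (inner ℝ (alg.action t p.1.1 p.1.2) θ + p.2))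

/-- The joint law of the seed and the first `t` rewards when the algorithm interacts with the
linear bandit with parameter `θ`: each round uses a fresh independent standard Gaussian noise. -/
noncomputable def interactionLaw (alg : Algorithm m Ω) (θ : EuclideanSpace ℝ (Fin m)) :
    (t : ℕ) → Measure (Ω × (Fin t → ℝ))
  | 0 => alg.seedLaw.map (fun ω => (ω, Fin.elim0))
  | t + 1 => ((interactionLaw alg θ t).prod (gaussianReal 0 1)).map (step alg θ t)

/-- The action of round `t < T`, as a function of the seed and of all `T` rewards (it looks at the
first `t` rewards only). -/
noncomputable def actionAt (alg : Algorithm m Ω) {T : ℕ} (t : Fin T) (p : Ω × (Fin T → ℝ)) :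
    EuclideanSpace ℝ (Fin m) :=
  alg.action t p.1 (fun i => p.2 (Fin.castLE t.is_lt.le i))

/-- The (pseudo-)regret after `T` rounds relative to always playing the action `b`, in the instance
with parameter `θ`. -/
noncomputable def regretAgainst (alg : Algorithm m Ω) (θ b : EuclideanSpace ℝ (Fin m)) (T : ℕ)
    (p : Ω × (Fin T → ℝ)) : ℝ :=
  ∑ t : Fin T, inner ℝ θ (b - actionAt alg t p)

/-- The expected hint-based regret for the hint `h`. -/
noncomputable def expectedHintRegret (alg : Algorithm m Ω) (h θ : EuclideanSpace ℝ (Fin m))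
    (T : ℕ) : ℝ :=
  ∫ p, regretAgainst alg θ h T p ∂(interactionLaw alg θ T)

/-- The optimal action `θ / ‖θ‖` of the unit ball, for `θ ≠ 0`. -/
noncomputable def optimalAction (θ : EuclideanSpace ℝ (Fin m)) : EuclideanSpace ℝ (Fin m) :=
  ‖θ‖⁻¹ • θ

/-- The expected regret relative to the optimal action. -/
noncomputable def expectedRegret (alg : Algorithm m Ω) (θ : EuclideanSpace ℝ (Fin m))
    (T : ℕ) : ℝ :=
  ∫ p, regretAgainst alg θ (optimalAction θ) T p ∂(interactionLaw alg θ T)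

theorem measurable_step (alg : Algorithm m Ω) (θ : EuclideanSpace ℝ (Fin m)) (t : ℕ) :
    Measurable (step alg θ t) := by
  unfold step
  refine (measurable_fst.comp measurable_fst).prodMk ?_
  refine measurable_pi_lambda _ (fun i => ?_)
  have hact : Measurable (fun p : (Ω × (Fin t → ℝ)) × ℝ => alg.action t p.1.1 p.1.2) :=
    (alg.measurable_action t).comp measurable_fst
  have hlast : Measurable (fun p : (Ω × (Fin t → ℝ)) × ℝ =>
      inner ℝ (alg.action t p.1.1 p.1.2) θ + p.2) :=
    (hact.inner measurable_const).add measurable_snd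
  refine Fin.lastCases ?_ (fun j => ?_) i
  · simpa using hlast
  · simpa [Function.comp_def] using (measurable_pi_apply j).comp (measurable_snd.comp measurable_fst)

instance isProbabilityMeasure_interactionLaw (alg : Algorithm m Ω)
    (θ : EuclideanSpace ℝ (Fin m)) (t : ℕ) :
    IsProbabilityMeasure (interactionLaw alg θ t) := by
  induction t with
  | zero =>
    exact Measure.isProbabilityMeasure_map
      (measurable_id.prodMk measurable_const).aemeasurable
  | succ t ih =>
    exact Measure.isProbabilityMeasure_map (measurable_step alg θ t).aemeasurable

theorem measurable_actionAt (alg : Algorithm m Ω) {T : ℕ} (t : Fin T) :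
    Measurable (actionAt alg t) :=
  (alg.measurable_action t).comp (measurable_fst.prodMk (measurable_pi_lambda _
    (fun i => (measurable_pi_apply (Fin.castLE t.is_lt.le i)).comp measurable_snd)))

/-- The integrals above are genuine expectations: the regret is bounded and measurable. -/
theorem integrable_regretAgainst (alg : Algorithm m Ω) (θ b : EuclideanSpace ℝ (Fin m)) (T : ℕ) :
    Integrable (regretAgainst alg θ b T) (interactionLaw alg θ T) := by
  unfold regretAgainst
  refine integrable_finsetSum _ (fun t _ => ?_)
  refine Integrable.of_bound (C := ‖θ‖ * (‖b‖ + 1)) ?_ (Filter.Eventually.of_forall fun p => ?_)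
  · exact (measurable_const.inner
      (measurable_const.sub (measurable_actionAt alg t))).aestronglyMeasurable
  · refine (norm_inner_le_norm _ _).trans (mul_le_mul_of_nonneg_left ?_ (norm_nonneg _))
    exact (norm_sub_le _ _).trans (add_le_add_right (alg.norm_action_le _ _ _) _)

end HintBandit

namespace HintBandit

/-! Let `d ≥ 1` and take the null parameter `r • h` with `r = 20000`. There regret and hint regret
coincide; let `R` be their expectation. The `d` directions orthogonal to `h` share at most `2 (1 -
⟪h, a⟫)` of squared exploration per round, so in some direction `e` the exploration costs at most `R
/ d` (`exists_direction`). The alternatives `r • h ± (r * ρ) • e` differ from the null only in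
rewards collected along `e`, so a learner with small `R` cannot identify them, and failing to do so
costs about `r ρ² / 2` per round (`le_norm_sub_inner`).

Quantitatively, each round is a three-point estimation problem with values `0, ρ, -ρ` and weights
`1, 1/2, 1/2`. With `C` the mean likelihood ratio of the alternatives and `q = exp (-energy)` the
product of the two ratios, the posterior minimum is `ρ² (C + q) / (1 + C)` (`bayesRisk_le`). Its
null expectation is bounded below for adaptive designs by a logarithmic minorant (`certificate`)
equal to a submartingale minus `11/100` of the energy, minus `C / 100`, up to constants. The
submartingale property is a heat inequality in (energy, score) (`certCosh_heat_nonneg`,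
`heatCert_le_integral`), and `C` has null mean one. This gives `two_point_risk`.

Optimising `ρ` (`exists_scale`) yields regret at least `T d κ / (4 R₁) - R / d` for suitable `R₁ ≥
R`, with `κ = 2561/2500`. Together with the bound `R` at the null parameter this implies the claim
(`exists_level`). That step needs `κ > 1`, which is why the risk bound has such tight numerical
constants.

For `d = 0` the parameters `±r • h` suffice: zero hint regret forces the learner to play `h` even
when it is the worst action. -/

/-! ### Gaussian integration by parts and functions with nonnegative heat drift. -/

theorem integrable_gaussianReal_of_bound {φ : ℝ → ℝ} {B : ℝ} (hm : Measurable φ)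
    (hB : ∀ x, |φ x| ≤ B) : Integrable φ (gaussianReal 0 1) :=
  Integrable.of_bound hm.aestronglyMeasurable B (Filter.Eventually.of_forall hB)

theorem integrable_id_gaussianReal : Integrable (fun x : ℝ => x) (gaussianReal 0 1) :=
  (memLp_id_gaussianReal 1).integrable le_rfl

theorem integrable_id_mul_gaussianReal {φ : ℝ → ℝ} {B : ℝ} (hm : Measurable φ)
    (hB : ∀ x, |φ x| ≤ B) : Integrable (fun x => x * φ x) (gaussianReal 0 1) :=
  integrable_id_gaussianReal.mul_bdd hm.aestronglyMeasurable (Filter.Eventually.of_forall hB)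

/-- Gaussian integration by parts. -/
theorem integral_id_mul_gaussianReal {φ φ' : ℝ → ℝ} {B : ℝ}
    (hd : ∀ x, HasDerivAt φ (φ' x) x) (hB : ∀ x, |φ x| ≤ B) (hB' : ∀ x, |φ' x| ≤ B) :
    ∫ x, x * φ x ∂(gaussianReal 0 1) = ∫ x, φ' x ∂(gaussianReal 0 1) := by
  have hφ : Measurable φ :=
    (continuous_iff_continuousAt.2 fun x => (hd x).continuousAt).measurable
  have hφ' : Measurable φ' := by
    have : φ' = deriv φ := funext fun x => (hd x).deriv.symm
    rw [this]; exact measurable_deriv φ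
  have i1 := integrable_id_mul_gaussianReal hφ hB
  have i2 := integrable_gaussianReal_of_bound hφ' hB'
  rw [← sub_eq_zero, ← integral_sub i1 i2]
  have hpdf : ∀ x, HasDerivAt (gaussianPDFReal 0 1) (-x * gaussianPDFReal 0 1 x) x := by
    intro x
    have h1 : HasDerivAt (fun y : ℝ => -(y - 0) ^ 2 / (2 * ((1 : NNReal) : ℝ))) (-x) x := by
      have := (((hasDerivAt_id x).sub_const 0).pow 2).neg.div_const (2 * ((1 : NNReal) : ℝ))
      refine this.congr_deriv ?_
      simp
      ring
    have := (h1.exp).const_mul ((√(2 * Real.pi * ((1 : NNReal) : ℝ)))⁻¹)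
    refine this.congr_deriv ?_
    simp only [gaussianPDFReal]; ring
  have key : ∀ x, HasDerivAt (fun y => -(gaussianPDFReal 0 1 y * φ y))
      (gaussianPDFReal 0 1 x • (x * φ x - φ' x)) x := by
    intro x
    refine ((hpdf x).mul (hd x)).neg.congr_deriv ?_
    simp only [smul_eq_mul]; ring
  rw [integral_gaussianReal_eq_integral_smul (by simp)]
  have wd : ∀ {f : ℝ → ℝ}, Integrable f (gaussianReal 0 1) →
      Integrable (fun x => gaussianPDFReal 0 1 x • f x) := by
    intro f hf
    rw [gaussianReal_of_var_ne_zero _ (by simp)] at hf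
    rw [integrable_withDensity_iff_integrable_smul' (measurable_gaussianPDF 0 1)
      (Filter.Eventually.of_forall fun _ => gaussianPDF_lt_top)] at hf
    simpa [toReal_gaussianPDF] using hf
  refine integral_eq_zero_of_hasDerivAt_of_integrable key (wd (i1.sub i2)) ?_
  exact (wd (integrable_gaussianReal_of_bound hφ hB)).neg

/-- A function of `(x, w)` with nonnegative heat drift increases on average when `w` is moved by
a Gaussian increment of variance `v ^ 2` and `x` by `v ^ 2`. -/
theorem le_integral_gaussianReal_of_heat {K Kx Kw Kww : ℝ → ℝ → ℝ} {B x : ℝ} (hx : 0 ≤ x)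
    (hK : ∀ w ξ v, HasDerivAt (fun v => K (x + v ^ 2) (w + v * ξ))
      (2 * v * Kx (x + v ^ 2) (w + v * ξ) + ξ * Kw (x + v ^ 2) (w + v * ξ)) v)
    (hKw : ∀ y w, 0 ≤ y → HasDerivAt (Kw y) (Kww y w) w)
    (hKm : Measurable (Function.uncurry K)) (hKxm : Measurable (Function.uncurry Kx))
    (hBx : ∀ y w, 0 ≤ y → |Kx y w| ≤ B) (hBw : ∀ y w, 0 ≤ y → |Kw y w| ≤ B)
    (hBww : ∀ y w, 0 ≤ y → |Kww y w| ≤ B)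
    (hheat : ∀ y w, 0 ≤ y → 0 ≤ 2 * Kx y w + Kww y w) (w : ℝ) {v : ℝ} (hv : 0 ≤ v) :
    K x w ≤ ∫ ξ, K (x + v ^ 2) (w + v * ξ) ∂(gaussianReal 0 1) := by
  have hpos : ∀ v : ℝ, 0 ≤ x + v ^ 2 := fun v => by positivity
  have hB0 : 0 ≤ B := (abs_nonneg _).trans (hBx 0 0 le_rfl)
  have hKwm : ∀ y, 0 ≤ y → Measurable (Kw y) := fun y hy =>
    (continuous_iff_continuousAt.2 fun w => (hKw y w hy).continuousAt).measurable
  have mKx : ∀ v, Measurable (fun ξ => Kx (x + v ^ 2) (w + v * ξ)) := fun v =>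
    hKxm.comp (measurable_const.prodMk (by fun_prop))
  have mKw : ∀ v, Measurable (fun ξ => Kw (x + v ^ 2) (w + v * ξ)) := fun v =>
    (hKwm _ (hpos v)).comp (by fun_prop)
  have mK : ∀ v, Measurable (fun ξ => K (x + v ^ 2) (w + v * ξ)) := fun v =>
    hKm.comp (measurable_const.prodMk (by fun_prop))
  have hderbd : ∀ v R ξ, |v| ≤ R → |2 * v * Kx (x + v ^ 2) (w + v * ξ)
      + ξ * Kw (x + v ^ 2) (w + v * ξ)| ≤ 2 * R * B + |ξ| * B := by
    intro v R ξ hR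
    refine (abs_add_le _ _).trans (add_le_add ?_ ?_)
    · rw [abs_mul, abs_mul, abs_two]
      have := hBx (x + v ^ 2) (w + v * ξ) (hpos v)
      have hR0 : 0 ≤ R := (abs_nonneg v).trans hR
      gcongr
    · rw [abs_mul]; gcongr; exact hBw _ _ (hpos v)
  have ibd : ∀ R : ℝ, Integrable (fun ξ : ℝ => 2 * R * B + |ξ| * B) (gaussianReal 0 1) :=
    fun R => (integrable_const _).add (integrable_id_gaussianReal.abs.mul_const B)
  -- `K` itself is not assumed bounded. Its value at `v = 0` does not depend on `ξ`, and the
  -- derivative in `v` grows at most linearly in `|ξ|`.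
  have iK : ∀ v, Integrable (fun ξ => K (x + v ^ 2) (w + v * ξ)) (gaussianReal 0 1) := by
    intro v
    have hb : Integrable (fun ξ : ℝ => |K x w| + (2 * |v| * B + |ξ| * B) * |v|)
        (gaussianReal 0 1) :=
      (integrable_const _).add ((ibd |v|).mul_const _)
    refine hb.mono' (mK v).aestronglyMeasurable (Filter.Eventually.of_forall fun ξ => ?_)
    have := (convex_Icc (-|v|) |v|).norm_image_sub_le_of_norm_hasDerivWithin_le
      (f := fun v => K (x + v ^ 2) (w + v * ξ)) (C := 2 * |v| * B + |ξ| * B) (x := 0) (y := v)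
      (fun u _ => (hK w ξ u).hasDerivWithinAt)
      (fun u hu => hderbd u |v| ξ (abs_le.2 hu))
      ⟨by simp, by simp⟩ ⟨neg_abs_le v, le_abs_self v⟩
    simp only [Real.norm_eq_abs, sub_zero] at this
    norm_num at this
    rw [Real.norm_eq_abs]
    calc |K (x + v ^ 2) (w + v * ξ)|
        = |K x w + (K (x + v ^ 2) (w + v * ξ) - K x w)| := by ring_nf
      _ ≤ _ := (abs_add_le _ _).trans (add_le_add le_rfl this)
  set G : ℝ → ℝ := fun v => ∫ ξ, K (x + v ^ 2) (w + v * ξ) ∂(gaussianReal 0 1) with hG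
  have hGd : ∀ v, HasDerivAt G (∫ ξ, (2 * v * Kx (x + v ^ 2) (w + v * ξ)
      + ξ * Kw (x + v ^ 2) (w + v * ξ)) ∂(gaussianReal 0 1)) v := by
    intro v
    refine (hasDerivAt_integral_of_dominated_loc_of_deriv_le (s := Metric.ball v 1)
      (bound := fun ξ => 2 * (|v| + 1) * B + |ξ| * B) (Metric.ball_mem_nhds v one_pos)
      (Filter.Eventually.of_forall fun u => (mK u).aestronglyMeasurable) (iK v)
      (((mKx v).const_mul _).add (measurable_id.mul (mKw v))).aestronglyMeasurable
      (Filter.Eventually.of_forall fun ξ u hu => hderbd u _ ξ ?_) (ibd _)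
      (Filter.Eventually.of_forall fun ξ u _ => hK w ξ u)).2
    rw [Metric.mem_ball, Real.dist_eq] at hu
    have := abs_sub_abs_le_abs_sub u v
    linarith
  have hGnn : ∀ v, 0 ≤ v → 0 ≤ ∫ ξ, (2 * v * Kx (x + v ^ 2) (w + v * ξ)
      + ξ * Kw (x + v ^ 2) (w + v * ξ)) ∂(gaussianReal 0 1) := by
    intro v hv
    -- Integration by parts turns `ξ * Kw` into `v * Kww`, so the derivative of `G` is `v` times the
    -- mean of the drift `2 * Kx + Kww`.
    have e1 := integral_id_mul_gaussianReal (φ := fun ξ => Kw (x + v ^ 2) (w + v * ξ))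
      (φ' := fun ξ => Kww (x + v ^ 2) (w + v * ξ) * v) (B := max B (B * |v|))
      (fun ξ => by
        have h1 : HasDerivAt (fun ξ => w + v * ξ) v ξ := by
          simpa using ((hasDerivAt_id ξ).const_mul v).const_add w
        exact (hKw (x + v ^ 2) (w + v * ξ) (hpos v)).comp ξ h1)
      (fun ξ => (hBw _ _ (hpos v)).trans (le_max_left _ _))
      (fun ξ => by
        rw [abs_mul]
        exact (mul_le_mul_of_nonneg_right (hBww _ _ (hpos v)) (abs_nonneg v)).trans
          (le_max_right _ _))
    have ix : Integrable (fun ξ => Kx (x + v ^ 2) (w + v * ξ)) (gaussianReal 0 1) :=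
      integrable_gaussianReal_of_bound (mKx v) (fun ξ => hBx _ _ (hpos v))
    have iw := integrable_id_mul_gaussianReal (mKw v) (fun ξ => hBw _ _ (hpos v))
    have mKww : Measurable (fun ξ => Kww (x + v ^ 2) (w + v * ξ)) := by
      have : Kww (x + v ^ 2) = deriv (Kw (x + v ^ 2)) := funext fun y => (hKw _ y (hpos v)).deriv.symm
      rw [this]
      exact (measurable_deriv _).comp (by fun_prop)
    have iww : Integrable (fun ξ => Kww (x + v ^ 2) (w + v * ξ)) (gaussianReal 0 1) :=
      integrable_gaussianReal_of_bound mKww (fun ξ => hBww _ _ (hpos v))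
    rw [integral_add (ix.const_mul _) iw, e1, ← integral_add (ix.const_mul _) (iww.mul_const _)]
    refine integral_nonneg fun ξ => ?_
    have := mul_nonneg hv (hheat (x + v ^ 2) (w + v * ξ) (hpos v))
    simp only [Pi.zero_apply]
    linarith
  have hmono : MonotoneOn G (Set.Ici 0) := by
    refine monotoneOn_of_deriv_nonneg (convex_Ici 0)
      (fun u _ => (hGd u).continuousAt.continuousWithinAt)
      (fun u _ => (hGd u).differentiableAt.differentiableWithinAt) (fun u hu => ?_)
    rw [interior_Ici] at hu
    rw [(hGd u).deriv]
    exact hGnn u hu.le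
  have h0 : G 0 = K x w := by simp [hG]
  rw [← h0]
  exact hmono (by simp) hv hv

/-! ### The pointwise logarithmic lower bound for the Bayes risk. -/

/-- In terms of `C` and `q`, the function whose logarithm certifies the value of the sequential
testing problem. -/
noncomputable def certPoly (C q : ℝ) : ℝ :=
  C ^ 2 + C * (18 / 5 * q - 7 / 10 * q ^ 2) - 7 / 20 * q + 7 / 2 * q ^ 2 - 11 / 10 * q ^ 3

theorem certPoly_pos {C q : ℝ} (hC : 0 < C) (hq : 0 ≤ q) (hq1 : q ≤ 1) (hqC : q ≤ C ^ 2) :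
    0 < certPoly C q := by
  unfold certPoly
  have h1 : 0 ≤ C * (18 / 5 * q - 7 / 10 * q ^ 2) := by
    refine mul_nonneg hC.le ?_
    nlinarith
  have h2 : 0 ≤ 7 / 2 * q ^ 2 - 11 / 10 * q ^ 3 := by nlinarith [sq_nonneg q]
  nlinarith [pow_pos hC 2]

/-- Tangent to the logarithm at `m`. Centres `m` just below `119/20 * 2 ^ (k / 2)` are used, so that
`log 2` is the only transcendental number left and polynomial arithmetic finishes. -/
theorem log_le_tangent {N m : ℝ} {k : ℤ} (hN : 0 < N) (hm : 0 < m)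
    (hk : (m / (119 / 20)) ^ 2 ≤ 2 ^ k) :
    Real.log (N / (119 / 20)) ≤ N / m - 1 + k / 2 * Real.log 2 := by
  have h1 : Real.log (N / (119 / 20)) = Real.log (N / m) + Real.log (m / (119 / 20)) := by
    rw [← Real.log_mul (by positivity) (by positivity)]
    congr 1
    field_simp
  have h2 : Real.log (N / m) ≤ N / m - 1 := Real.log_le_sub_one_of_pos (by positivity)
  have h3 : 2 * Real.log (m / (119 / 20)) ≤ k * Real.log 2 := by
    have := Real.log_le_log (by positivity) hk
    rwa [Real.log_pow, Real.log_zpow, Nat.cast_ofNat] at this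
  linarith

theorem log_sq_le_tangent {C c : ℝ} {k : ℤ} (hC : 0 < C) (hc : 0 < c)
    (hk : c ^ 2 / (119 / 20) ≤ 2 ^ k) :
    Real.log (C ^ 2 / (119 / 20)) ≤ 2 * (C / c - 1) + k * Real.log 2 := by
  have h1 : Real.log (C ^ 2 / (119 / 20)) =
      2 * Real.log (C / c) + Real.log (c ^ 2 / (119 / 20)) := by
    have h0 : 2 * Real.log (C / c) = Real.log ((C / c) ^ 2) := by simp [Real.log_pow]
    rw [h0, ← Real.log_mul (by positivity) (by positivity)]
    congr 1
    field_simp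
  have h2 : Real.log (C / c) ≤ C / c - 1 := Real.log_le_sub_one_of_pos (by positivity)
  have h3 : Real.log (c ^ 2 / (119 / 20)) ≤ k * Real.log 2 := by
    have := Real.log_le_log (by positivity) hk
    rwa [Real.log_zpow] at this
  linarith

/-- The case `q = 0`, to which large `C` is reduced. On each interval of `C` the logarithm is
replaced by a tangent at `c` close to `√(119/20 * 2 ^ k)`, leaving a quadratic inequality. -/
theorem certificate_zero {C : ℝ} (hC : 23 / 50 ≤ C) :
    (1363 / 2000 + 11 / 100 * Real.log (C ^ 2 / (119 / 20)) - C / 100) * (1 + C) ≤ C := by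
  have hC0 : 0 < C := by linarith
  have l1 := Real.log_two_gt_d9
  have l2 := Real.log_two_lt_d9
  have key : ∀ (c : ℝ) (k : ℤ), 0 < c → c ^ 2 / (119 / 20) ≤ 2 ^ k →
      (1363 / 2000 + 11 / 100 * (2 * (C / c - 1) + k * Real.log 2) - C / 100) * (1 + C) ≤ C →
      (1363 / 2000 + 11 / 100 * Real.log (C ^ 2 / (119 / 20)) - C / 100) * (1 + C) ≤ C := by
    intro c k hc hk h
    refine le_trans (mul_le_mul_of_nonneg_right ?_ (by linarith)) h
    have := log_sq_le_tangent hC0 hc hk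
    linarith
  rcases le_total C (26 / 50) with h1 | h1
  · refine key (4312 / 10000) (-5) (by norm_num) (by norm_num) ?_
    push_cast
    nlinarith
  rcases le_total C (86 / 100) with h2 | h2
  · refine key (6098 / 10000) (-4) (by norm_num) (by norm_num) ?_
    push_cast
    nlinarith
  rcases le_total C (172 / 100) with h3 | h3
  · refine key (12196 / 10000) (-2) (by norm_num) (by norm_num) ?_
    push_cast
    nlinarith
  rcases le_total C 4 with h4 | h4
  · refine key (24392 / 10000) 0 (by norm_num) (by norm_num) ?_
    push_cast
    nlinarith
  rcases le_total C (98 / 10) with h5 | h5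
  · refine key (68992 / 10000) 3 (by norm_num) (by norm_num) ?_
    push_cast
    nlinarith
  rcases le_total C (164 / 10) with h6 | h6
  · refine key (137984 / 10000) 5 (by norm_num) (by norm_num) ?_
    push_cast
    nlinarith
  rcases le_total C (232 / 10) with h7 | h7
  · refine key (195140 / 10000) 6 (by norm_num) (by norm_num) ?_
    push_cast
    nlinarith
  · refine key (275970 / 10000) 7 (by norm_num) (by norm_num) ?_
    push_cast
    nlinarith

theorem certificate_of_large {C q : ℝ} (hC : 23 / 50 ≤ C) (hq : 0 ≤ q) (hq1 : q ≤ 1)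
    (hqC : q ≤ C ^ 2) :
    (1363 / 2000 + 11 / 100 * Real.log (certPoly C q / (119 / 20)) - C / 100) * (1 + C)
      ≤ C + q := by
  have hC0 : 0 < C := by linarith
  have hN := certPoly_pos hC0 hq hq1 hqC
  -- This rate makes `11/100 * k * (1 + C) = 1`: if `certPoly` grows in `q` no faster than `exp (k *
  -- q)`, the gain on the left is at most the term `q` on the right. The bounds `e1` and `e2`
  -- compare the coefficients of `q` and `q ^ 2` with the exponential series; the cubic term is
  -- negative.
  set k : ℝ := 100 / (11 * (1 + C)) with hk
  have hk' : k * (11 * (1 + C)) = 100 := by rw [hk]; field_simp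
  have hk0 : 0 < k := by positivity
  have e1 : 18 / 5 * C - 7 / 20 ≤ C ^ 2 * k := by
    rw [hk, mul_div_assoc', le_div_iff₀ (by positivity)]
    nlinarith [sq_nonneg (C - 23 / 50)]
  have e2 : 7 / 2 - 7 / 10 * C ≤ C ^ 2 * (k ^ 2 / 2) := by
    rw [hk, div_pow, div_div, mul_div_assoc', le_div_iff₀ (by positivity)]
    nlinarith [sq_nonneg (C - 23 / 50), mul_nonneg (sub_nonneg.2 hC) (sq_nonneg C),
      mul_nonneg (sub_nonneg.2 hC) (sq_nonneg (C - 1))]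
  have hle : certPoly C q ≤ C ^ 2 * Real.exp (k * q) := by
    have h1 := Real.quadratic_le_exp_of_nonneg (x := k * q) (by positivity)
    have h2 := mul_le_mul_of_nonneg_left h1 (sq_nonneg C)
    refine le_trans ?_ h2
    have a1 := mul_le_mul_of_nonneg_right e1 hq
    have a2 := mul_le_mul_of_nonneg_right e2 (sq_nonneg q)
    have a3 : 0 ≤ q ^ 3 := by positivity
    unfold certPoly
    nlinarith
  have hlog : Real.log (certPoly C q / (119 / 20)) ≤ Real.log (C ^ 2 / (119 / 20)) + k * q := by
    have h1 : Real.log (certPoly C q / (119 / 20)) ≤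
        Real.log (C ^ 2 / (119 / 20) * Real.exp (k * q)) := by
      refine Real.log_le_log (by positivity) ?_
      rw [div_mul_eq_mul_div]
      gcongr
    rwa [Real.log_mul (by positivity) (Real.exp_ne_zero _), Real.log_exp] at h1
  have h0 := certificate_zero hC
  have h1 : (11 / 100 * (k * q)) * (1 + C) = q := by
    linear_combination q / 100 * hk'
  nlinarith [mul_le_mul_of_nonneg_right hlog (by linarith : (0:ℝ) ≤ 1 + C)]

/-- Reduces one region of the `(C, q)` plane to a polynomial inequality: `M` is a convenient upper
bound for `certPoly`, and `34657/100000` lies just below half of `log 2`. -/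
theorem certificate_of_tangent {C q m M : ℝ} (k : ℕ) (hC : 0 < C) (hq : 0 ≤ q) (hq1 : q ≤ 1)
    (hqC : q ≤ C ^ 2) (hm : 0 < m) (hk : (m / (119 / 20)) ^ 2 ≤ 2 ^ (-(k : ℤ)))
    (hM : certPoly C q ≤ M)
    (h : (1363 / 2000 + 11 / 100 * (M / m - 1 - k * (34657 / 100000)) - C / 100) * (1 + C)
      ≤ C + q) :
    (1363 / 2000 + 11 / 100 * Real.log (certPoly C q / (119 / 20)) - C / 100) * (1 + C)
      ≤ C + q := by
  refine le_trans (mul_le_mul_of_nonneg_right ?_ (by linarith)) h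
  have l1 := Real.log_two_gt_d9
  have h1 := log_le_tangent (certPoly_pos hC hq hq1 hqC) hm hk
  have h2 : certPoly C q / m ≤ M / m := by gcongr
  have h3 : (k : ℝ) * (34657 / 100000) ≤ k / 2 * Real.log 2 := by
    have : (0 : ℝ) ≤ k := k.cast_nonneg
    nlinarith
  push_cast at h1
  linarith

theorem certPoly_le {C q : ℝ} (hC : 2 / 10 ≤ C) (hq : 0 ≤ q) (hqC : q ≤ C ^ 2) :
    certPoly C q ≤ C ^ 2 + 18 / 5 * C * q - 339 / 1000 * q + 31 / 10 * q ^ 2 := by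
  have : 0 ≤ 11 / 1000 - (4 / 10 - 7 / 10 * C) * q + 11 / 10 * q ^ 2 := by
    rcases le_total C (26 / 100) with h | h
    · nlinarith [sq_nonneg (q - 6 / 100), mul_nonneg (sub_nonneg.2 h) (sub_nonneg.2 hqC),
        mul_nonneg (sub_nonneg.2 h) (sub_nonneg.2 hC)]
    · nlinarith [sq_nonneg (q - 1 / 10)]
  unfold certPoly
  nlinarith [mul_nonneg hq this]

theorem certificate_of_small {C q : ℝ} (hC0 : 0 < C) (hC : C ≤ 26 / 100) (hq : 0 ≤ q)
    (hqC : q ≤ C ^ 2) :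
    (1363 / 2000 + 11 / 100 * Real.log (certPoly C q / (119 / 20)) - C / 100) * (1 + C)
      ≤ C + q := by
  have hq1 : q ≤ 1 := by nlinarith
  have hM : certPoly C q ≤ C ^ 2 + 18 / 5 * C * q - 7 / 20 * q + 7 / 2 * q ^ 2 := by
    have : 0 ≤ C * q ^ 2 := by positivity
    have : 0 ≤ q ^ 3 := by positivity
    unfold certPoly
    linarith
  rcases le_total C (1 / 10) with h1 | h1
  · refine certificate_of_tangent (m := 232 / 10000) 16 hC0 hq hq1 hqC (by norm_num)
      (by norm_num) hM ?_
    norm_num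
    nlinarith [mul_nonneg hC0.le hq, mul_nonneg hC0.le (sub_nonneg.2 h1),
      mul_nonneg hq (sub_nonneg.2 h1), mul_nonneg hq (sub_nonneg.2 hqC)]
  rcases le_total C (2 / 10) with h2 | h2
  · refine certificate_of_tangent (m := 464 / 10000) 14 hC0 hq hq1 hqC (by norm_num)
      (by norm_num) hM ?_
    norm_num
    nlinarith [mul_nonneg hC0.le hq, mul_nonneg (sub_nonneg.2 h1) (sub_nonneg.2 h2),
      mul_nonneg hq (sub_nonneg.2 h2), mul_nonneg hq (sub_nonneg.2 hqC)]
  · refine certificate_of_tangent (m := 929 / 10000) 12 hC0 hq hq1 hqC (by norm_num)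
      (by norm_num) (certPoly_le h2 hq hqC) ?_
    norm_num
    have hq2 : q ≤ 46 / 100 * C - 52 / 1000 := by nlinarith
    have e := sub_nonneg.2 h2
    have f := sub_nonneg.2 hC
    have b2 := mul_nonneg f e
    have b4 := mul_nonneg hq (sub_nonneg.2 hq2)
    have b6 := mul_nonneg (sub_nonneg.2 hq2) f
    linarith [mul_nonneg hq f, mul_nonneg hq e, mul_nonneg (sub_nonneg.2 hq2) e,
      mul_nonneg b2 e, mul_nonneg b2 f, mul_nonneg b4 e, mul_nonneg b4 f,
      mul_nonneg (mul_nonneg hq e) e, mul_nonneg b6 e,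
      mul_nonneg (mul_nonneg (sub_nonneg.2 hq2) e) e, mul_nonneg b2 hq, mul_nonneg b6 f,
      mul_nonneg (mul_nonneg hq f) f]

theorem certificate_of_medium_of_le {C q t : ℝ} (hC0 : 26 / 100 ≤ C) (hC : C ≤ 23 / 50)
    (hq : 0 ≤ q) (hqC : q ≤ C ^ 2) (ht : q = t - 7 / 10 * C) (ht1 : t ≤ 33 / 100) :
    (1363 / 2000 + 11 / 100 * Real.log (certPoly C q / (119 / 20)) - C / 100) * (1 + C)
      ≤ C + q := by
  have hq1 : q ≤ 1 := by nlinarith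
  have hC1 : 0 < C := by linarith
  have hM := certPoly_le (by linarith) hq hqC
  rcases le_total t (273 / 1000) with h4 | h4
  · refine certificate_of_tangent (m := 1314 / 10000) 11 hC1 hq hq1 hqC (by norm_num)
      (by norm_num) hM ?_
    subst ht
    have a1 := mul_nonneg hq (sub_nonneg.2 hC0)
    have a2 := mul_nonneg hq (sub_nonneg.2 hC)
    have a3 := mul_nonneg (sub_nonneg.2 hC) (sub_nonneg.2 hC0)
    have a4 := mul_nonneg hq (sub_nonneg.2 hqC)
    have a5 := mul_nonneg a3 hq
    have a6 := mul_nonneg a3 hC1.le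
    have b1 := mul_nonneg hq (sub_nonneg.2 h4)
    have b3 := mul_nonneg (sub_nonneg.2 hC0) (sub_nonneg.2 h4)
    norm_num
    nlinarith [mul_nonneg b1 hC1.le]
  · refine certificate_of_tangent (m := 1859 / 10000) 10 hC1 hq hq1 hqC (by norm_num)
      (by norm_num) hM ?_
    subst ht
    have a1 := mul_nonneg hq (sub_nonneg.2 hC0)
    have a2 := mul_nonneg hq (sub_nonneg.2 hC)
    have a3 := mul_nonneg (sub_nonneg.2 hC) (sub_nonneg.2 hC0)
    have a4 := mul_nonneg hq (sub_nonneg.2 hqC)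
    have a5 := mul_nonneg a3 hq
    have a6 := mul_nonneg a3 hC1.le
    have c1 := mul_nonneg (sub_nonneg.2 hC0) (sub_nonneg.2 h4)
    have c2 := mul_nonneg (sub_nonneg.2 hC) (sub_nonneg.2 h4)
    have b1 := mul_nonneg (sub_nonneg.2 h4) (sub_nonneg.2 ht1)
    have b3 := mul_nonneg (sub_nonneg.2 hC0) (sub_nonneg.2 ht1)
    have b4 := mul_nonneg (sub_nonneg.2 hC) (sub_nonneg.2 ht1)
    norm_num
    nlinarith [mul_nonneg b1 hC1.le]

theorem certificate_of_medium_of_ge {C q t : ℝ} (hC0 : 26 / 100 ≤ C) (hC : C ≤ 23 / 50)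
    (hq : 0 ≤ q) (hqC : q ≤ C ^ 2) (ht : q = t - 7 / 10 * C) (ht1 : 33 / 100 ≤ t) :
    (1363 / 2000 + 11 / 100 * Real.log (certPoly C q / (119 / 20)) - C / 100) * (1 + C)
      ≤ C + q := by
  have hq1 : q ≤ 1 := by nlinarith
  have hC1 : 0 < C := by linarith
  have hM := certPoly_le (by linarith) hq hqC
  rcases le_total t (40 / 100) with h6 | h6
  · refine certificate_of_tangent (m := 2629 / 10000) 9 hC1 hq hq1 hqC (by norm_num)
      (by norm_num) hM ?_
    subst ht
    have a1 := mul_nonneg hq (sub_nonneg.2 hC0)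
    have a2 := mul_nonneg hq (sub_nonneg.2 hC)
    have a3 := mul_nonneg (sub_nonneg.2 hC) (sub_nonneg.2 hC0)
    have a4 := mul_nonneg hq (sub_nonneg.2 hqC)
    have a5 := mul_nonneg a3 hq
    have a6 := mul_nonneg a3 hC1.le
    have b1 := mul_nonneg (sub_nonneg.2 ht1) (sub_nonneg.2 h6)
    have b3 := mul_nonneg (sub_nonneg.2 hC0) (sub_nonneg.2 h6)
    have b4 := mul_nonneg (sub_nonneg.2 hC) (sub_nonneg.2 h6)
    norm_num
    nlinarith [mul_nonneg b1 hC1.le]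
  · refine certificate_of_tangent (m := 3718 / 10000) 8 hC1 hq hq1 hqC (by norm_num)
      (by norm_num) hM ?_
    have h7 : 40 / 100 ≤ q + 7 / 10 * C := by linarith
    clear ht h6 ht1
    have h8 : 37 / 100 ≤ C := by nlinarith
    have b4 := mul_nonneg hq (sub_nonneg.2 hqC)
    have b2 := mul_nonneg (sub_nonneg.2 hC) (sub_nonneg.2 h8)
    have b3 := mul_nonneg hq (sub_nonneg.2 hC)
    norm_num
    nlinarith [mul_nonneg b4 (sub_nonneg.2 h8)]

/-- The logarithmic certificate lies below the three-point Bayes risk `(C + q) / (1 + C)`. -/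
theorem certificate {C q : ℝ} (hC0 : 0 < C) (hq : 0 ≤ q) (hq1 : q ≤ 1) (hqC : q ≤ C ^ 2) :
    1363 / 2000 + 11 / 100 * Real.log (certPoly C q / (119 / 20)) - C / 100
      ≤ (C + q) / (1 + C) := by
  rw [le_div_iff₀ (by linarith)]
  rcases le_total C (23 / 50) with h | h
  · rcases le_total C (26 / 100) with h1 | h1
    · exact certificate_of_small hC0 h1 hq hqC
    -- For intermediate `C`, the quantity `q + 7/10 * C` selects the tangent centre.
    · rcases le_total (q + 7 / 10 * C) (33 / 100) with h2 | h2
      · exact certificate_of_medium_of_le h1 h hq hqC (by ring) h2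
      · exact certificate_of_medium_of_ge h1 h hq hqC (by ring) h2
  · exact certificate_of_large h hq hq1 hqC

/-! ### The heat inequality behind the submartingale. -/

/-- `certPoly` divided by `q`, in terms of `s = √q` and `c = C / s`. -/
noncomputable def certCosh (s c : ℝ) : ℝ :=
  c ^ 2 + (18 / 5 * s - 7 / 10 * s ^ 3) * c - 7 / 20 + 7 / 2 * s ^ 2 - 11 / 10 * s ^ 4

theorem certPoly_eq (s c : ℝ) : certPoly (s * c) (s ^ 2) = s ^ 2 * certCosh s c := by
  unfold certPoly certCosh; ring

theorem le_certCosh {s c : ℝ} (hs : 0 ≤ s) (hs1 : s ≤ 1) (hc : 1 ≤ c) :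
    13 / 20 * c ^ 2 ≤ certCosh s c := by
  unfold certCosh
  have h1 : 0 ≤ (18 / 5 * s - 7 / 10 * s ^ 3) * c := by
    refine mul_nonneg ?_ (by linarith)
    nlinarith [mul_nonneg hs (sub_nonneg.2 hs1), mul_nonneg (sq_nonneg s) (sub_nonneg.2 hs1)]
  have h2 : s ^ 4 ≤ s ^ 2 := pow_le_pow_of_le_one hs hs1 (by norm_num)
  nlinarith [sq_nonneg s]

theorem certCosh_pos {s c : ℝ} (hs : 0 ≤ s) (hs1 : s ≤ 1) (hc : 1 ≤ c) : 0 < certCosh s c :=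
  lt_of_lt_of_le (by positivity) (le_certCosh hs hs1 hc)

/-- This is `2 Kx + Kww ≥ 0` for `K = log (certCosh s c)`, `s = exp (-x/2)`, `c = cosh w`, after
clearing the positive denominator and writing `sinh² w = c² - 1`. Expanded in powers of `c - 1`, the
difference of the two sides has all coefficients nonnegative for `0 ≤ s ≤ 1`. -/
theorem certCosh_heat_nonneg {s c : ℝ} (hs : 0 ≤ s) (hs1 : s ≤ 1) (hc : 1 ≤ c) :
    (2 * c + (18 / 5 * s - 7 / 10 * s ^ 3)) ^ 2 * (c ^ 2 - 1) ≤
      certCosh s c * (4 * c ^ 2 - 2 + (18 / 5 * s - 7 / 10 * s ^ 3) * c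
        - s * ((18 / 5 - 21 / 10 * s ^ 2) * c + 7 * s - 22 / 5 * s ^ 3)) := by
  have a : 0 ≤ s * (1 - s) := mul_nonneg hs (by linarith)
  -- `p0`, `p1`, `p2` are the coefficients of `(c - 1) ^ 0`, `(c - 1) ^ 1`, `(c - 1) ^ 2`; the cubic
  -- coefficient is `7/5 * s ^ 3`.
  have p0 : 0 ≤ 13 / 10 + 36 / 5 * s + 49 / 20 * s ^ 2 - 2569 / 100 * s ^ 3 - 94 / 5 * s ^ 4
      + 641 / 25 * s ^ 5 + 553 / 25 * s ^ 6 - 231 / 50 * s ^ 7 - 121 / 25 * s ^ 8 := by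
    nlinarith [mul_nonneg hs (sq_nonneg (s ^ 2 - 3 / 4)),
      mul_nonneg (pow_nonneg hs 3) (sq_nonneg (s - 3 / 4)),
      mul_nonneg (pow_nonneg hs 2) (sq_nonneg (s ^ 2 - 3 / 4)), sq_nonneg (s ^ 2 - 3 / 4),
      sq_nonneg (s - 3 / 4), mul_nonneg a (pow_nonneg hs 3), mul_nonneg a (pow_nonneg hs 5),
      mul_nonneg a (pow_nonneg hs 6), mul_nonneg a (pow_nonneg hs 4),
      mul_nonneg (pow_nonneg hs 4) (sq_nonneg (s ^ 2 - 3 / 4)),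
      mul_nonneg (pow_nonneg hs 3) (sq_nonneg (s ^ 2 - 3 / 4))]
  have p1 : 0 ≤ 6 / 5 + 36 / 5 * s - 298 / 25 * s ^ 2 - 2289 / 100 * s ^ 3 + 504 / 25 * s ^ 4
      + 641 / 25 * s ^ 5 - 147 / 50 * s ^ 6 - 231 / 50 * s ^ 7 := by
    nlinarith [mul_nonneg hs (sq_nonneg (s ^ 2 - 3 / 5)),
      mul_nonneg (pow_nonneg hs 3) (sq_nonneg (s - 3 / 4)),
      mul_nonneg (pow_nonneg hs 2) (sq_nonneg (s - 3 / 4)), sq_nonneg (s ^ 2 - 3 / 5),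
      sq_nonneg (s - 3 / 4), mul_nonneg a (pow_nonneg hs 3), mul_nonneg a (pow_nonneg hs 5),
      mul_nonneg a (pow_nonneg hs 4), mul_nonneg (pow_nonneg hs 3) (sq_nonneg (s ^ 2 - 3 / 5))]
  have p2 : 0 ≤ 3 / 5 - 149 / 25 * s ^ 2 + 21 / 5 * s ^ 3 + 252 / 25 * s ^ 4
      - 147 / 100 * s ^ 6 := by
    nlinarith [mul_nonneg hs (sq_nonneg (s - 1 / 2)),
      mul_nonneg (pow_nonneg hs 2) (sq_nonneg (s - 1 / 2)), sq_nonneg (s ^ 2 - 1 / 4),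
      sq_nonneg (s ^ 2 - 1 / 5), sq_nonneg (s - 1 / 2), mul_nonneg a (pow_nonneg hs 3),
      mul_nonneg a (pow_nonneg hs 4), sq_nonneg (s ^ 2 - 2 / 5 * s)]
  have hu : 0 ≤ c - 1 := by linarith
  have h1 := mul_nonneg p1 hu
  have h2 := mul_nonneg p2 (pow_nonneg hu 2)
  have h3 := mul_nonneg (mul_nonneg (by norm_num : (0 : ℝ) ≤ 7 / 5) (pow_nonneg hs 3))
    (pow_nonneg hu 3)
  unfold certCosh
  linarith

/-- The drift-controlled part of the certificate as a function of the accumulated energy and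
score. -/
noncomputable def heatCert (x w : ℝ) : ℝ :=
  Real.log (certCosh (Real.exp (-(x / 2))) (Real.cosh w))

theorem exp_neg_half_mem {x : ℝ} (hx : 0 ≤ x) :
    0 < Real.exp (-(x / 2)) ∧ Real.exp (-(x / 2)) ≤ 1 :=
  ⟨Real.exp_pos _, Real.exp_le_one_iff.2 (by linarith)⟩

theorem measurable_heatCert : Measurable (Function.uncurry heatCert) := by
  have : Measurable fun p : ℝ × ℝ =>
      certCosh (Real.exp (-(p.1 / 2))) (Real.cosh p.2) := by
    unfold certCosh
    have h1 : Measurable fun p : ℝ × ℝ => Real.exp (-(p.1 / 2)) := by fun_prop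
    have h2 : Measurable fun p : ℝ × ℝ => Real.cosh p.2 :=
      Real.continuous_cosh.measurable.comp measurable_snd
    fun_prop
  exact Real.measurable_log.comp this

theorem sinh_abs_le_cosh (w : ℝ) : |Real.sinh w| ≤ Real.cosh w := by
  rw [abs_le]
  constructor
  · have := Real.cosh_add_sinh w ▸ (Real.exp_pos w).le
    linarith
  · exact (Real.sinh_lt_cosh w).le

/-- One round of the submartingale: given the past, the energy grows by `v ^ 2` and the score by `v
* ξ`. Evenness in `w` allows `v` of either sign. The derivatives are bounded because `certCosh` is
at least a multiple of `cosh ^ 2`. -/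
theorem heatCert_le_integral {x : ℝ} (hx : 0 ≤ x) (w v : ℝ) :
    heatCert x w ≤ ∫ ξ, heatCert (x + v ^ 2) (w + v * ξ) ∂(gaussianReal 0 1) := by
  wlog hv : 0 ≤ v generalizing w v
  · have h := this (-w) (-v) (by linarith)
    have e : ∀ y z, heatCert y (-z) = heatCert y z := fun y z => by simp [heatCert]
    rw [e] at h
    refine h.trans_eq (integral_congr_ae (Filter.Eventually.of_forall fun ξ => ?_))
    have : -w + -v * ξ = -(w + v * ξ) := by ring
    simp only [this, e, neg_sq]
  set S : ℝ → ℝ := fun y => Real.exp (-(y / 2)) with hS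
  set A : ℝ → ℝ := fun s => 18 / 5 * s - 7 / 10 * s ^ 3 with hA
  set Ms : ℝ → ℝ → ℝ := fun s c => (18 / 5 - 21 / 10 * s ^ 2) * c + 7 * s - 22 / 5 * s ^ 3
    with hMs
  have hpos : ∀ y w, 0 ≤ y → 0 < certCosh (S y) (Real.cosh w) := fun y w hy =>
    certCosh_pos (exp_neg_half_mem hy).1.le (exp_neg_half_mem hy).2 (Real.one_le_cosh w)
  have hSd : ∀ y, HasDerivAt S (-(S y / 2)) y := by
    intro y
    have := ((hasDerivAt_id y).div_const 2).neg.exp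
    refine this.congr_deriv ?_
    simp [hS]; ring
  have hM : ∀ (a b : ℝ → ℝ) (a' b' u : ℝ), HasDerivAt a a' u → HasDerivAt b b' u →
      HasDerivAt (fun u => certCosh (a u) (b u))
        (a' * Ms (a u) (b u) + b' * (2 * b u + A (a u))) u := by
    intro a b a' b' u ha hb
    have := ((((hb.pow 2).add (((ha.const_mul (18 / 5)).sub ((ha.pow 3).const_mul (7 / 10))).mul
      hb)).sub_const (7 / 20)).add ((ha.pow 2).const_mul (7 / 2))).sub
      ((ha.pow 4).const_mul (11 / 10))
    refine this.congr_deriv ?_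
    simp [hMs, hA]; ring
  have hfacts : ∀ y w, 0 ≤ y → 0 < S y ∧ S y ≤ 1 ∧ 1 ≤ Real.cosh w ∧
      (0 ≤ A (S y) ∧ A (S y) ≤ 4) ∧ (0 < certCosh (S y) (Real.cosh w) ∧
        13 / 20 * Real.cosh w ^ 2 ≤ certCosh (S y) (Real.cosh w)) := by
    intro y w hy
    obtain ⟨h0, h1⟩ := exp_neg_half_mem hy
    refine ⟨h0, h1, Real.one_le_cosh w, ⟨?_, ?_⟩, hpos y w hy,
      le_certCosh h0.le h1 (Real.one_le_cosh w)⟩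
    · have := pow_le_of_le_one h0.le h1 (n := 3) (by norm_num)
      simp only [hA, hS]; linarith
    · have := pow_pos h0 3
      simp only [hA, hS]; linarith
  have hfacts' : ∀ y w, 0 ≤ y → |Real.sinh w * (2 * Real.cosh w + A (S y))| ≤
      6 * Real.cosh w ^ 2 := by
    intro y w hy
    obtain ⟨h0, h1, h2, h3, h4⟩ := hfacts y w hy
    rw [abs_mul, abs_of_nonneg (by linarith : 0 ≤ 2 * Real.cosh w + A (S y))]
    have := mul_le_mul (sinh_abs_le_cosh w) (by linarith : 2 * Real.cosh w + A (S y) ≤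
      6 * Real.cosh w) (by linarith) (by linarith)
    linarith
  refine le_integral_gaussianReal_of_heat (B := 100)
    (Kx := fun y w => -(S y / 2) * Ms (S y) (Real.cosh w) / certCosh (S y) (Real.cosh w))
    (Kw := fun y w => (Real.sinh w * (2 * Real.cosh w + A (S y))) /
      certCosh (S y) (Real.cosh w))
    (Kww := fun y w => ((Real.cosh w * (2 * Real.cosh w + A (S y)) +
      Real.sinh w * (2 * Real.sinh w)) * certCosh (S y) (Real.cosh w) -
      (Real.sinh w * (2 * Real.cosh w + A (S y))) * (Real.sinh w * (2 * Real.cosh w + A (S y))))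
      / certCosh (S y) (Real.cosh w) ^ 2)
    hx ?_ ?_ measurable_heatCert ?_ ?_ ?_ ?_ ?_ w hv
  · intro w ξ u
    have h1 : HasDerivAt (fun u : ℝ => x + u ^ 2) (2 * u) u := by
      simpa using (hasDerivAt_pow 2 u).const_add x
    have h2 : HasDerivAt (fun u : ℝ => w + u * ξ) ξ u := by
      simpa using ((hasDerivAt_id u).mul_const ξ).const_add w
    have hy : 0 ≤ x + u ^ 2 := by positivity
    have h3 := (hM _ _ _ _ u ((hSd (x + u ^ 2)).comp u h1)
      ((Real.hasDerivAt_cosh (w + u * ξ)).comp u h2)).log (hpos (x + u ^ 2) (w + u * ξ) hy).ne'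
    refine h3.congr_deriv ?_
    simp only [Function.comp_apply]
    ring
  · intro y w hy
    have h1 := hM (fun _ => S y) Real.cosh 0 (Real.sinh w) w (hasDerivAt_const w (S y))
      (Real.hasDerivAt_cosh w)
    have h2 : HasDerivAt (fun w => Real.sinh w * (2 * Real.cosh w + A (S y)))
        (Real.cosh w * (2 * Real.cosh w + A (S y)) + Real.sinh w * (2 * Real.sinh w)) w :=
      (Real.hasDerivAt_sinh w).mul (((Real.hasDerivAt_cosh w).const_mul 2).add_const _)
    refine (h2.div h1 (hpos y w hy).ne').congr_deriv ?_
    ring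
  · have h1 : Measurable fun p : ℝ × ℝ => S p.1 := by simp only [hS]; fun_prop
    have h2 : Measurable fun p : ℝ × ℝ => Real.cosh p.2 :=
      Real.continuous_cosh.measurable.comp measurable_snd
    simp only [Function.uncurry_def, hMs, certCosh]
    fun_prop
  · intro y w hy
    obtain ⟨h0, h1, h2, h3, h4⟩ := hfacts y w hy
    rw [abs_div, abs_of_pos h4.1, div_le_iff₀ h4.1]
    refine le_trans ?_ (mul_le_mul_of_nonneg_left h4.2 (by norm_num))
    have h5 : 0 ≤ Ms (S y) (Real.cosh w) := by
      simp only [hMs]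
      nlinarith [mul_nonneg h0.le (sub_nonneg.2 h1), mul_nonneg h0.le h0.le,
        mul_nonneg (mul_nonneg h0.le h0.le) (sub_nonneg.2 h1),
        pow_le_one₀ h0.le h1 (n := 2), pow_le_one₀ h0.le h1 (n := 3)]
    have h6 : Ms (S y) (Real.cosh w) ≤ 11 * Real.cosh w ^ 2 := by
      simp only [hMs]
      nlinarith [pow_pos h0 3, mul_nonneg (sq_nonneg (S y)) (zero_le_one.trans h2)]
    rw [abs_mul, abs_neg, abs_of_pos (by positivity), abs_of_nonneg h5]
    nlinarith [sq_nonneg (Real.cosh w)]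
  · intro y w hy
    obtain ⟨h0, h1, h2, h3, h4⟩ := hfacts y w hy
    rw [abs_div, abs_of_pos h4.1, div_le_iff₀ h4.1]
    refine le_trans (hfacts' y w hy) ?_
    nlinarith [h4.2, sq_nonneg (Real.cosh w)]
  · intro y w hy
    obtain ⟨h0, h1, h2, h3, h4⟩ := hfacts y w hy
    have h5 := hfacts' y w hy
    rw [abs_div, abs_of_pos (pow_pos h4.1 2), div_le_iff₀ (pow_pos h4.1 2)]
    have hc2 : 0 ≤ Real.cosh w ^ 2 := sq_nonneg _
    have h6 : |Real.cosh w * (2 * Real.cosh w + A (S y)) + Real.sinh w * (2 * Real.sinh w)|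
        ≤ 8 * Real.cosh w ^ 2 := by
      rw [abs_of_nonneg (by nlinarith [sq_nonneg (Real.sinh w)])]
      nlinarith [Real.cosh_sq w]
    have h7 : (13 / 20 * Real.cosh w ^ 2) ^ 2 ≤ certCosh (S y) (Real.cosh w) ^ 2 := by
      gcongr; exact h4.2
    refine (abs_sub _ _).trans ?_
    rw [abs_mul, abs_mul (_ * _), abs_of_pos h4.1]
    have h8 := mul_le_mul h5 h5 (abs_nonneg _) (by positivity)
    have h9 := mul_le_mul_of_nonneg_right h6 h4.1.le
    have h10 := mul_le_mul_of_nonneg_right h4.2 h4.1.le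
    nlinarith
  · intro y w hy
    obtain ⟨h0, h1, h2, h3, h4⟩ := hfacts y w hy
    have h5 := certCosh_heat_nonneg h0.le h1 h2
    have hne := h4.1.ne'
    have e : ∀ X Y Z W : ℝ, 2 * (-(S y / 2) * X / certCosh (S y) (Real.cosh w)) +
        ((Y + Z) * certCosh (S y) (Real.cosh w) - W) / certCosh (S y) (Real.cosh w) ^ 2 =
        (certCosh (S y) (Real.cosh w) * (Y + Z - S y * X) - W) /
          certCosh (S y) (Real.cosh w) ^ 2 := by
      intro X Y Z W
      field_simp
      ring
    rw [e]
    refine div_nonneg (sub_nonneg.2 ?_) (sq_nonneg _)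
    have hs2 : Real.sinh w * Real.sinh w = Real.cosh w ^ 2 - 1 := by
      rw [Real.cosh_sq]; ring
    calc _ = (2 * Real.cosh w + A (S y)) ^ 2 * (Real.sinh w * Real.sinh w) := by ring
      _ = _ := by rw [hs2]
      _ ≤ _ := h5
      _ = _ := by
        congr 1
        have : Real.sinh w * (2 * Real.sinh w) = 2 * (Real.cosh w ^ 2 - 1) := by
          rw [← hs2]; ring
        rw [this]
        simp only [hA, hMs]
        ring

/-! ### Likelihood ratios of adaptive experiments. -/

variable {m : ℕ} {Ω : Type*} [MeasurableSpace Ω]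

/-- The density of a unit Gaussian of mean `δ` relative to the centred one is `exp (δ * ξ - δ ^ 2 /
2)`. -/
theorem lintegral_gaussianReal_add (δ : ℝ) {F : ℝ → ENNReal} (hF : Measurable F) :
    ∫⁻ ξ, F (ξ + δ) ∂(gaussianReal 0 1) =
      ∫⁻ ξ, ENNReal.ofReal (Real.exp (δ * ξ - δ ^ 2 / 2)) * F ξ ∂(gaussianReal 0 1) := by
  have h1 : ∫⁻ ξ, F (ξ + δ) ∂(gaussianReal 0 1) = ∫⁻ ξ, F ξ ∂(gaussianReal δ 1) := by
    rw [← lintegral_map hF (measurable_add_const δ), gaussianReal_map_add_const, zero_add]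
  have hexp : Measurable fun ξ : ℝ => ENNReal.ofReal (Real.exp (δ * ξ - δ ^ 2 / 2)) := by
    fun_prop
  rw [h1, gaussianReal_of_var_ne_zero _ one_ne_zero, gaussianReal_of_var_ne_zero _ one_ne_zero,
    lintegral_withDensity_eq_lintegral_mul _ (measurable_gaussianPDF _ _) hF,
    lintegral_withDensity_eq_lintegral_mul _ (measurable_gaussianPDF _ _)
      (g := fun ξ => ENNReal.ofReal (Real.exp (δ * ξ - δ ^ 2 / 2)) * F ξ) (hexp.mul hF)]
  refine lintegral_congr fun ξ => ?_
  simp only [Pi.mul_apply, ← mul_assoc]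
  congr 1
  rw [gaussianPDF, gaussianPDF, ← ENNReal.ofReal_mul (gaussianPDFReal_nonneg _ _ _)]
  congr 1
  simp only [gaussianPDFReal, mul_assoc, ← Real.exp_add]
  congr 2
  simp only [NNReal.coe_one]
  ring

/-- The accumulated product of the noise with the component of the actions along `v`, when the
parameter is `θ₀`. -/
noncomputable def score (alg : Algorithm m Ω) (θ₀ v : EuclideanSpace ℝ (Fin m)) :
    (t : ℕ) → Ω × (Fin t → ℝ) → ℝ
  | 0, _ => 0
  | t + 1, p => score alg θ₀ v t (p.1, Fin.init p.2) +
      inner ℝ (alg.action t p.1 (Fin.init p.2)) v *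
        (p.2 (Fin.last t) - inner ℝ (alg.action t p.1 (Fin.init p.2)) θ₀)

/-- The accumulated squared component of the actions along `v`. -/
noncomputable def energy (alg : Algorithm m Ω) (v : EuclideanSpace ℝ (Fin m)) :
    (t : ℕ) → Ω × (Fin t → ℝ) → ℝ
  | 0, _ => 0
  | t + 1, p => energy alg v t (p.1, Fin.init p.2) +
      inner ℝ (alg.action t p.1 (Fin.init p.2)) v ^ 2

theorem score_step (alg : Algorithm m Ω) (θ₀ v : EuclideanSpace ℝ (Fin m)) (t : ℕ)
    (p : Ω × (Fin t → ℝ)) (ξ : ℝ) :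
    score alg θ₀ v (t + 1) (step alg θ₀ t (p, ξ)) =
      score alg θ₀ v t p + inner ℝ (alg.action t p.1 p.2) v * ξ := by
  simp [score, step]

theorem energy_step (alg : Algorithm m Ω) (θ₀ v : EuclideanSpace ℝ (Fin m)) (t : ℕ)
    (p : Ω × (Fin t → ℝ)) (ξ : ℝ) :
    energy alg v (t + 1) (step alg θ₀ t (p, ξ)) =
      energy alg v t p + inner ℝ (alg.action t p.1 p.2) v ^ 2 := by
  simp [energy, step]

theorem step_add (alg : Algorithm m Ω) (θ₀ v : EuclideanSpace ℝ (Fin m)) (t : ℕ)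
    (p : Ω × (Fin t → ℝ)) (ξ : ℝ) :
    step alg (θ₀ + v) t (p, ξ) =
      step alg θ₀ t (p, ξ + inner ℝ (alg.action t p.1 p.2) v) := by
  simp only [step, inner_add_right]
  congr 2
  ring

theorem measurable_init_pair (t : ℕ) :
    Measurable fun p : Ω × (Fin (t + 1) → ℝ) => (p.1, Fin.init p.2) :=
  measurable_fst.prodMk (measurable_pi_lambda _ fun i =>
    (measurable_pi_apply i.castSucc).comp measurable_snd)

theorem measurable_inner_action (alg : Algorithm m Ω) (v : EuclideanSpace ℝ (Fin m)) (t : ℕ) :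
    Measurable fun p : Ω × (Fin t → ℝ) => (inner ℝ (alg.action t p.1 p.2) v : ℝ) :=
  (alg.measurable_action t).inner measurable_const

theorem measurable_score (alg : Algorithm m Ω) (θ₀ v : EuclideanSpace ℝ (Fin m)) (t : ℕ) :
    Measurable (score alg θ₀ v t) := by
  induction t with
  | zero => exact measurable_const
  | succ t ih =>
    exact (ih.comp (measurable_init_pair t)).add
      (((measurable_inner_action alg v t).comp (measurable_init_pair t)).mul
        (((measurable_pi_apply (Fin.last t)).comp measurable_snd).sub
          ((measurable_inner_action alg θ₀ t).comp (measurable_init_pair t))))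

theorem measurable_energy (alg : Algorithm m Ω) (v : EuclideanSpace ℝ (Fin m)) (t : ℕ) :
    Measurable (energy alg v t) := by
  induction t with
  | zero => exact measurable_const
  | succ t ih =>
    exact (ih.comp (measurable_init_pair t)).add
      (((measurable_inner_action alg v t).comp (measurable_init_pair t)).pow_const 2)

theorem score_neg (alg : Algorithm m Ω) (θ₀ v : EuclideanSpace ℝ (Fin m)) (t : ℕ)
    (p : Ω × (Fin t → ℝ)) : score alg θ₀ (-v) t p = -score alg θ₀ v t p := by
  induction t with
  | zero => simp [score]
  | succ t ih => simp only [score, ih, inner_neg_right]; ring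

theorem energy_neg (alg : Algorithm m Ω) (v : EuclideanSpace ℝ (Fin m)) (t : ℕ)
    (p : Ω × (Fin t → ℝ)) : energy alg (-v) t p = energy alg v t p := by
  induction t with
  | zero => simp [energy]
  | succ t ih => simp only [energy, ih, inner_neg_right, neg_sq]

theorem abs_inner_action_le (alg : Algorithm m Ω) (v : EuclideanSpace ℝ (Fin m)) (t : ℕ)
    (ω : Ω) (y : Fin t → ℝ) : |(inner ℝ (alg.action t ω y) v : ℝ)| ≤ ‖v‖ :=
  (abs_real_inner_le_norm _ _).trans
    (mul_le_of_le_one_left (norm_nonneg _) (alg.norm_action_le t ω y))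

theorem energy_nonneg (alg : Algorithm m Ω) (v : EuclideanSpace ℝ (Fin m)) (t : ℕ)
    (p : Ω × (Fin t → ℝ)) : 0 ≤ energy alg v t p := by
  induction t with
  | zero => simp [energy]
  | succ t ih => exact add_nonneg (ih _) (sq_nonneg _)

theorem energy_le (alg : Algorithm m Ω) (v : EuclideanSpace ℝ (Fin m)) (t : ℕ)
    (p : Ω × (Fin t → ℝ)) : energy alg v t p ≤ t * ‖v‖ ^ 2 := by
  induction t with
  | zero => simp [energy]
  | succ t ih =>
    have h := sq_le_sq' (abs_le.1 (abs_inner_action_le alg v t p.1 (Fin.init p.2))).1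
      (abs_le.1 (abs_inner_action_le alg v t p.1 (Fin.init p.2))).2
    push_cast
    have := add_le_add (ih (p.1, Fin.init p.2)) h
    simp only [energy]
    linarith

theorem lintegral_interactionLaw_succ (alg : Algorithm m Ω) (θ : EuclideanSpace ℝ (Fin m))
    (t : ℕ) {f : Ω × (Fin (t + 1) → ℝ) → ENNReal} (hf : Measurable f) :
    ∫⁻ p, f p ∂(interactionLaw alg θ (t + 1)) =
      ∫⁻ p, ∫⁻ ξ, f (step alg θ t (p, ξ)) ∂(gaussianReal 0 1) ∂(interactionLaw alg θ t) := by
  rw [interactionLaw, lintegral_map hf (measurable_step alg θ t),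
    lintegral_prod (fun z => f (step alg θ t z))
      (hf.comp (measurable_step alg θ t)).aemeasurable]

/-- Given the past, the action is fixed and changing the parameter by `v` shifts the next reward by
`⟪a, v⟫`. The one-step Gaussian densities multiply, adaptivity notwithstanding. -/
theorem lintegral_interactionLaw_add (alg : Algorithm m Ω) (θ₀ v : EuclideanSpace ℝ (Fin m))
    (t : ℕ) {f : Ω × (Fin t → ℝ) → ENNReal} (hf : Measurable f) :
    ∫⁻ p, f p ∂(interactionLaw alg (θ₀ + v) t) =
      ∫⁻ p, ENNReal.ofReal (Real.exp (score alg θ₀ v t p - energy alg v t p / 2)) * f p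
        ∂(interactionLaw alg θ₀ t) := by
  induction t with
  | zero => simp [interactionLaw, score, energy]
  | succ t ih =>
    have hw : Measurable fun p => ENNReal.ofReal
        (Real.exp (score alg θ₀ v (t + 1) p - energy alg v (t + 1) p / 2)) :=
      ((measurable_score alg θ₀ v (t + 1)).sub
        ((measurable_energy alg v (t + 1)).div_const 2)).exp.ennreal_ofReal
    have hstep : ∀ p : Ω × (Fin t → ℝ), Measurable fun ξ : ℝ => step alg θ₀ t (p, ξ) :=
      fun p => (measurable_step alg θ₀ t).comp (measurable_const.prodMk measurable_id)
    have hin : Measurable fun z : (Ω × (Fin t → ℝ)) × ℝ =>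
        ENNReal.ofReal (Real.exp (inner ℝ (alg.action t z.1.1 z.1.2) v * z.2 -
          inner ℝ (alg.action t z.1.1 z.1.2) v ^ 2 / 2)) * f (step alg θ₀ t z) := by
      have h1 := (measurable_inner_action alg v t).comp
        (measurable_fst : Measurable (Prod.fst : (Ω × (Fin t → ℝ)) × ℝ → _))
      exact (((h1.mul measurable_snd).sub ((h1.pow_const 2).div_const 2)).exp.ennreal_ofReal).mul
        (hf.comp (measurable_step alg θ₀ t))
    rw [lintegral_interactionLaw_succ alg _ t hf,
      lintegral_interactionLaw_succ alg _ t (f := fun p => ENNReal.ofReal (Real.exp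
        (score alg θ₀ v (t + 1) p - energy alg v (t + 1) p / 2)) * f p) (hw.mul hf)]
    simp only [step_add]
    have e1 : ∀ p : Ω × (Fin t → ℝ), ∫⁻ ξ, f (step alg θ₀ t
        (p, ξ + inner ℝ (alg.action t p.1 p.2) v)) ∂(gaussianReal 0 1) =
        ∫⁻ ξ, ENNReal.ofReal (Real.exp (inner ℝ (alg.action t p.1 p.2) v * ξ -
          inner ℝ (alg.action t p.1 p.2) v ^ 2 / 2)) * f (step alg θ₀ t (p, ξ))
          ∂(gaussianReal 0 1) := fun p =>
      lintegral_gaussianReal_add _ (F := fun ξ => f (step alg θ₀ t (p, ξ)))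
        (hf.comp (hstep p))
    simp only [e1]
    rw [ih hin.lintegral_prod_right']
    refine lintegral_congr fun p => ?_
    have hinp : Measurable fun ξ : ℝ => ENNReal.ofReal (Real.exp
        (inner ℝ (alg.action t p.1 p.2) v * ξ - inner ℝ (alg.action t p.1 p.2) v ^ 2 / 2)) *
          f (step alg θ₀ t (p, ξ)) := by
      have h1 : Measurable fun ξ : ℝ => ENNReal.ofReal (Real.exp
          (inner ℝ (alg.action t p.1 p.2) v * ξ -
            inner ℝ (alg.action t p.1 p.2) v ^ 2 / 2)) := by fun_prop
      exact h1.mul (hf.comp (hstep p))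
    rw [← lintegral_const_mul _ hinp]
    refine lintegral_congr fun ξ => ?_
    rw [← mul_assoc]
    rw [← ENNReal.ofReal_mul (Real.exp_pos _).le, ← Real.exp_add, score_step, energy_step]
    congr 3
    ring

/-- The likelihood ratio of two parameters. -/
theorem interactionLaw_add (alg : Algorithm m Ω) (θ₀ v : EuclideanSpace ℝ (Fin m)) (t : ℕ) :
    interactionLaw alg (θ₀ + v) t = (interactionLaw alg θ₀ t).withDensity fun p =>
      ENNReal.ofReal (Real.exp (score alg θ₀ v t p - energy alg v t p / 2)) := by
  have hw : Measurable fun p => ENNReal.ofReal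
      (Real.exp (score alg θ₀ v t p - energy alg v t p / 2)) :=
    ((measurable_score alg θ₀ v t).sub
      ((measurable_energy alg v t).div_const 2)).exp.ennreal_ofReal
  refine Measure.ext_of_lintegral _ fun f hf => ?_
  rw [lintegral_interactionLaw_add alg θ₀ v t hf, lintegral_withDensity_eq_lintegral_mul _ hw hf]
  rfl

theorem integral_interactionLaw_add (alg : Algorithm m Ω) (θ₀ v : EuclideanSpace ℝ (Fin m))
    (t : ℕ) (g : Ω × (Fin t → ℝ) → ℝ) :
    ∫ p, g p ∂(interactionLaw alg (θ₀ + v) t) =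
      ∫ p, Real.exp (score alg θ₀ v t p - energy alg v t p / 2) * g p
        ∂(interactionLaw alg θ₀ t) := by
  have hw : Measurable fun p => ENNReal.ofReal
      (Real.exp (score alg θ₀ v t p - energy alg v t p / 2)) :=
    ((measurable_score alg θ₀ v t).sub
      ((measurable_energy alg v t).div_const 2)).exp.ennreal_ofReal
  rw [interactionLaw_add, integral_withDensity_eq_integral_toReal_smul hw
    (Filter.Eventually.of_forall fun _ => ENNReal.ofReal_lt_top)]
  simp [ENNReal.toReal_ofReal (Real.exp_pos _).le]

theorem integrable_likelihood (alg : Algorithm m Ω) (θ₀ v : EuclideanSpace ℝ (Fin m)) (t : ℕ) :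
    Integrable (fun p => Real.exp (score alg θ₀ v t p - energy alg v t p / 2))
      (interactionLaw alg θ₀ t) := by
  have hm : Measurable fun p => Real.exp (score alg θ₀ v t p - energy alg v t p / 2) :=
    ((measurable_score alg θ₀ v t).sub ((measurable_energy alg v t).div_const 2)).exp
  refine ⟨hm.aestronglyMeasurable, ?_⟩
  rw [hasFiniteIntegral_iff_ofReal (Filter.Eventually.of_forall fun _ => (Real.exp_pos _).le)]
  have := lintegral_interactionLaw_add alg θ₀ v t (f := fun _ => 1) measurable_const
  simp only [lintegral_const, measure_univ, mul_one] at this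
  rw [← this]
  exact ENNReal.one_lt_top

theorem integral_likelihood (alg : Algorithm m Ω) (θ₀ v : EuclideanSpace ℝ (Fin m)) (t : ℕ) :
    ∫ p, Real.exp (score alg θ₀ v t p - energy alg v t p / 2) ∂(interactionLaw alg θ₀ t) = 1 := by
  have := integral_interactionLaw_add alg θ₀ v t (fun _ => 1)
  simp only [mul_one] at this
  rw [← this]
  simp

theorem integral_interactionLaw_succ (alg : Algorithm m Ω) (θ : EuclideanSpace ℝ (Fin m))
    (t : ℕ) {f : Ω × (Fin (t + 1) → ℝ) → ℝ} (hf : Measurable f)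
    (hi : Integrable f (interactionLaw alg θ (t + 1))) :
    ∫ p, f p ∂(interactionLaw alg θ (t + 1)) =
      ∫ p, ∫ ξ, f (step alg θ t (p, ξ)) ∂(gaussianReal 0 1) ∂(interactionLaw alg θ t) := by
  have hs := measurable_step alg θ t
  rw [interactionLaw] at hi ⊢
  rw [integral_map hs.aemeasurable hf.aestronglyMeasurable]
  exact integral_prod _ ((integrable_map_measure hf.aestronglyMeasurable hs.aemeasurable).1 hi)

/-- The action of a round depends only on earlier rewards, so its term may be integrated against the
law of those alone. -/
theorem integral_regretAgainst (alg : Algorithm m Ω) (θ b : EuclideanSpace ℝ (Fin m)) (T : ℕ) :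
    ∫ p, regretAgainst alg θ b T p ∂(interactionLaw alg θ T) =
      ∑ t ∈ Finset.range T, ∫ p, inner ℝ θ (b - alg.action t p.1 p.2)
        ∂(interactionLaw alg θ t) := by
  induction T with
  | zero => simp [regretAgainst]
  | succ T ih =>
    have hm : ∀ T, Measurable (regretAgainst alg θ b T) := fun T => by
      unfold regretAgainst
      exact Finset.measurable_sum _ fun t _ =>
        measurable_const.inner (measurable_const.sub (measurable_actionAt alg t))
    rw [integral_interactionLaw_succ alg θ T (hm _) (integrable_regretAgainst alg θ b (T + 1)),
      Finset.sum_range_succ, ← ih, ← integral_add (integrable_regretAgainst alg θ b T)]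
    · refine integral_congr_ae (Filter.Eventually.of_forall fun p => ?_)
      have : ∀ ξ : ℝ, regretAgainst alg θ b (T + 1) (step alg θ T (p, ξ)) =
          regretAgainst alg θ b T p + inner ℝ θ (b - alg.action T p.1 p.2) := by
        intro ξ
        simp only [regretAgainst, Fin.sum_univ_castSucc]
        congr 1
        · refine Finset.sum_congr rfl fun t _ => ?_
          simp only [actionAt, step]
          congr 3
          funext i
          exact Fin.snoc_castSucc (α := fun _ => ℝ) _ _ (Fin.castLE t.is_lt.le i)
        · simp only [actionAt, step]
          congr 3
          funext i
          exact Fin.snoc_castSucc (α := fun _ => ℝ) _ _ i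
      simp [this]
    · refine Integrable.of_bound (C := ‖θ‖ * (‖b‖ + 1)) ?_
        (Filter.Eventually.of_forall fun p => ?_)
      · exact (measurable_const.inner (measurable_const.sub
          (alg.measurable_action T))).aestronglyMeasurable
      · refine (norm_inner_le_norm _ _).trans (mul_le_mul_of_nonneg_left ?_ (norm_nonneg _))
        exact (norm_sub_le _ _).trans (add_le_add_right (alg.norm_action_le _ _ _) _)

theorem integrable_energy (alg : Algorithm m Ω) (θ v : EuclideanSpace ℝ (Fin m)) (t : ℕ) :
    Integrable (energy alg v t) (interactionLaw alg θ t) :=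
  Integrable.of_bound (measurable_energy alg v t).aestronglyMeasurable (t * ‖v‖ ^ 2)
    (Filter.Eventually.of_forall fun p => by
      rw [Real.norm_eq_abs, abs_of_nonneg (energy_nonneg alg v t p)]
      exact energy_le alg v t p)

theorem integrable_inner_action_sq (alg : Algorithm m Ω) (θ v : EuclideanSpace ℝ (Fin m))
    (t : ℕ) : Integrable (fun p => (inner ℝ (alg.action t p.1 p.2) v : ℝ) ^ 2)
      (interactionLaw alg θ t) :=
  Integrable.of_bound ((measurable_inner_action alg v t).pow_const 2).aestronglyMeasurable
    (‖v‖ ^ 2) (Filter.Eventually.of_forall fun p => by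
      rw [Real.norm_eq_abs, abs_of_nonneg (sq_nonneg _), ← sq_abs]
      have := abs_inner_action_le alg v t p.1 p.2
      gcongr)

theorem integral_energy (alg : Algorithm m Ω) (θ v : EuclideanSpace ℝ (Fin m)) (t : ℕ) :
    ∫ p, energy alg v t p ∂(interactionLaw alg θ t) = ∑ s ∈ Finset.range t,
      ∫ p, (inner ℝ (alg.action s p.1 p.2) v : ℝ) ^ 2 ∂(interactionLaw alg θ s) := by
  induction t with
  | zero => simp [energy]
  | succ t ih =>
    rw [integral_interactionLaw_succ alg θ t (measurable_energy alg v _)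
      (integrable_energy alg θ v _), Finset.sum_range_succ, ← ih,
      ← integral_add (integrable_energy alg θ v t) (integrable_inner_action_sq alg θ v t)]
    simp [energy_step]

/-! ### The expected three-point Bayes risk. -/

/-- The average of the likelihood ratios of `θ₀ + v` and `θ₀ - v`. -/
noncomputable def meanLikelihood (alg : Algorithm m Ω) (θ₀ v : EuclideanSpace ℝ (Fin m)) (t : ℕ)
    (p : Ω × (Fin t → ℝ)) : ℝ :=
  Real.exp (-(energy alg v t p / 2)) * Real.cosh (score alg θ₀ v t p)

theorem meanLikelihood_eq (alg : Algorithm m Ω) (θ₀ v : EuclideanSpace ℝ (Fin m)) (t : ℕ)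
    (p : Ω × (Fin t → ℝ)) : meanLikelihood alg θ₀ v t p =
      (Real.exp (score alg θ₀ v t p - energy alg v t p / 2) +
        Real.exp (score alg θ₀ (-v) t p - energy alg (-v) t p / 2)) / 2 := by
  rw [meanLikelihood, Real.cosh_eq, score_neg, energy_neg, sub_eq_add_neg, sub_eq_add_neg,
    Real.exp_add, Real.exp_add]
  ring

theorem integrable_meanLikelihood (alg : Algorithm m Ω) (θ₀ v : EuclideanSpace ℝ (Fin m))
    (t : ℕ) : Integrable (meanLikelihood alg θ₀ v t) (interactionLaw alg θ₀ t) := by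
  rw [funext (meanLikelihood_eq alg θ₀ v t)]
  exact ((integrable_likelihood alg θ₀ v t).add (integrable_likelihood alg θ₀ (-v) t)).div_const 2

theorem integral_meanLikelihood (alg : Algorithm m Ω) (θ₀ v : EuclideanSpace ℝ (Fin m))
    (t : ℕ) : ∫ p, meanLikelihood alg θ₀ v t p ∂(interactionLaw alg θ₀ t) = 1 := by
  simp only [meanLikelihood_eq]
  rw [integral_div, integral_add (integrable_likelihood alg θ₀ v t)
    (integrable_likelihood alg θ₀ (-v) t), integral_likelihood, integral_likelihood]
  norm_num

theorem abs_heatCert_le {x : ℝ} (hx : 0 ≤ x) (w : ℝ) : |heatCert x w| ≤ 13 * Real.cosh w := by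
  obtain ⟨h0, h1⟩ := exp_neg_half_mem hx
  have hc := Real.one_le_cosh w
  unfold heatCert
  set s := Real.exp (-(x / 2))
  set c := Real.cosh w
  have hlo := le_certCosh h0.le h1 hc
  have hup : certCosh s c ≤ 12 * c ^ 2 := by
    unfold certCosh
    have := pow_pos h0 3
    have := pow_pos h0 4
    have : s * c ≤ c := mul_le_of_le_one_left (by linarith) h1
    have : 0 ≤ s ^ 3 * c := by positivity
    have : s ^ 2 ≤ 1 := pow_le_one₀ h0.le h1
    nlinarith
  have hpos := certCosh_pos h0.le h1 hc
  rw [abs_le]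
  constructor
  · have h2 := Real.one_sub_inv_le_log_of_pos hpos
    have h3 : (certCosh s c)⁻¹ ≤ 2 := by
      rw [inv_le_comm₀ hpos (by norm_num)]
      nlinarith
    linarith
  · have h2 : Real.log (certCosh s c) ≤ Real.log (12 * c ^ 2) := Real.log_le_log hpos hup
    rw [Real.log_mul (by norm_num) (by positivity), Real.log_pow] at h2
    have h3 := Real.log_le_sub_one_of_pos (by norm_num : (0 : ℝ) < 12)
    have h4 := Real.log_le_sub_one_of_pos (by linarith : 0 < c)
    push_cast at h2
    linarith

theorem measurable_heatCert_state (alg : Algorithm m Ω) (θ₀ v : EuclideanSpace ℝ (Fin m))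
    (t : ℕ) : Measurable fun p => heatCert (energy alg v t p) (score alg θ₀ v t p) := by
  have h := measurable_heatCert.comp
    ((measurable_energy alg v t).prodMk (measurable_score alg θ₀ v t))
  simpa only [Function.comp_def, Function.uncurry_apply_pair] using h

theorem integrable_heatCert (alg : Algorithm m Ω) (θ₀ v : EuclideanSpace ℝ (Fin m)) (t : ℕ) :
    Integrable (fun p => heatCert (energy alg v t p) (score alg θ₀ v t p))
      (interactionLaw alg θ₀ t) := by
  -- The energy is at most `t * ‖v‖ ^ 2`, so `cosh` of the score is at most a constant times the
  -- integrable mean likelihood.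
  refine ((integrable_meanLikelihood alg θ₀ v t).const_mul
    (13 * Real.exp (t * ‖v‖ ^ 2 / 2))).mono' ?_ (Filter.Eventually.of_forall fun p => ?_)
  · exact (measurable_heatCert_state alg θ₀ v t).aestronglyMeasurable
  · refine (abs_heatCert_le (energy_nonneg alg v t p) _).trans ?_
    rw [meanLikelihood, mul_assoc, ← mul_assoc (Real.exp _), ← Real.exp_add]
    have h1 : 1 ≤ Real.exp (t * ‖v‖ ^ 2 / 2 + -(energy alg v t p / 2)) := by
      refine Real.one_le_exp ?_
      have := energy_le alg v t p
      linarith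
    have h2 := le_mul_of_one_le_left (Real.cosh_pos (score alg θ₀ v t p)).le h1
    linarith

theorem integrable_integral_step (alg : Algorithm m Ω) (θ : EuclideanSpace ℝ (Fin m))
    (t : ℕ) {f : Ω × (Fin (t + 1) → ℝ) → ℝ} (hf : Measurable f)
    (hi : Integrable f (interactionLaw alg θ (t + 1))) :
    Integrable (fun p => ∫ ξ, f (step alg θ t (p, ξ)) ∂(gaussianReal 0 1))
      (interactionLaw alg θ t) := by
  have hs := measurable_step alg θ t
  rw [interactionLaw] at hi
  exact ((integrable_map_measure hf.aestronglyMeasurable hs.aemeasurable).1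
    hi).integral_prod_left

/-- The submartingale starts at `log (certCosh 1 1)`, whence the constant `119/20`. -/
theorem log_le_integral_heatCert (alg : Algorithm m Ω) (θ₀ v : EuclideanSpace ℝ (Fin m))
    (t : ℕ) : Real.log (119 / 20) ≤
      ∫ p, heatCert (energy alg v t p) (score alg θ₀ v t p) ∂(interactionLaw alg θ₀ t) := by
  induction t with
  | zero =>
    have : heatCert 0 0 = Real.log (119 / 20) := by
      simp only [heatCert, certCosh]
      norm_num
    simp [energy, score, this]
  | succ t ih =>
    have hm := measurable_heatCert_state alg θ₀ v (t + 1)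
    have hi := integrable_heatCert alg θ₀ v (t + 1)
    have hint := integrable_integral_step alg θ₀ t hm hi
    rw [integral_interactionLaw_succ alg θ₀ t hm hi]
    refine ih.trans (integral_mono (integrable_heatCert alg θ₀ v t) hint fun p => ?_)
    have := heatCert_le_integral (energy_nonneg alg v t p) (score alg θ₀ v t p)
      (inner ℝ (alg.action t p.1 p.2) v)
    simpa only [energy_step, score_step] using this

/-- The three-point Bayes risk cannot decrease faster than linearly in the expected energy. -/
theorem le_integral_bayesRisk (alg : Algorithm m Ω) (θ₀ v : EuclideanSpace ℝ (Fin m)) (t : ℕ) :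
    1343 / 2000 - 11 / 100 * ∫ p, energy alg v t p ∂(interactionLaw alg θ₀ t) ≤
      ∫ p, (meanLikelihood alg θ₀ v t p + Real.exp (-energy alg v t p)) /
        (1 + meanLikelihood alg θ₀ v t p) ∂(interactionLaw alg θ₀ t) := by
  have i1 := integrable_heatCert alg θ₀ v t
  have i2 := integrable_energy alg θ₀ v t
  have i3 := integrable_meanLikelihood alg θ₀ v t
  have hC : ∀ p, 0 < meanLikelihood alg θ₀ v t p := fun p =>
    mul_pos (Real.exp_pos _) (Real.cosh_pos _)
  have hq1 : ∀ p, Real.exp (-energy alg v t p) ≤ 1 := fun p =>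
    Real.exp_le_one_iff.2 (neg_nonpos.2 (energy_nonneg alg v t p))
  have hqs : ∀ p, Real.exp (-energy alg v t p) = Real.exp (-(energy alg v t p / 2)) ^ 2 := by
    intro p
    rw [← Real.exp_nat_mul]
    congr 1
    push_cast
    ring
  have hCm : Measurable (meanLikelihood alg θ₀ v t) := by
    unfold meanLikelihood
    exact ((measurable_energy alg v t).div_const 2).neg.exp.mul
      (Real.continuous_cosh.measurable.comp (measurable_score alg θ₀ v t))
  have iR : Integrable (fun p => (meanLikelihood alg θ₀ v t p + Real.exp (-energy alg v t p)) /
      (1 + meanLikelihood alg θ₀ v t p)) (interactionLaw alg θ₀ t) := by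
    refine Integrable.of_bound ?_ 1 (Filter.Eventually.of_forall fun p => ?_)
    · exact ((hCm.add (measurable_energy alg v t).neg.exp).div
        (hCm.const_add 1)).aestronglyMeasurable
    · have h1 := hC p
      have h2 := hq1 p
      have h3 := Real.exp_pos (-energy alg v t p)
      rw [Real.norm_eq_abs, abs_of_pos (by positivity), div_le_one (by positivity)]
      linarith
  -- Integrating this gives the claim: `log q = -energy` yields the linear loss, the `heatCert` term
  -- is bounded by the submartingale, and the mean likelihood integrates to one, turning `1363/2000`
  -- into `1343/2000`. The constraint `q ≤ C ^ 2` is `1 ≤ cosh`.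
  have key : ∀ p, 1363 / 2000 + 11 / 100 * (heatCert (energy alg v t p) (score alg θ₀ v t p)
      - energy alg v t p - Real.log (119 / 20)) - meanLikelihood alg θ₀ v t p / 100 ≤
      (meanLikelihood alg θ₀ v t p + Real.exp (-energy alg v t p)) /
        (1 + meanLikelihood alg θ₀ v t p) := by
    intro p
    obtain ⟨h0, h1⟩ := exp_neg_half_mem (energy_nonneg alg v t p)
    have hc := Real.one_le_cosh (score alg θ₀ v t p)
    refine le_trans (le_of_eq ?_) (certificate (hC p) (Real.exp_pos _).le (hq1 p) ?_)
    · have e : certPoly (meanLikelihood alg θ₀ v t p) (Real.exp (-energy alg v t p)) =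
          Real.exp (-energy alg v t p) *
            certCosh (Real.exp (-(energy alg v t p / 2))) (Real.cosh (score alg θ₀ v t p)) := by
        rw [hqs, meanLikelihood, certPoly_eq]
      have hp := certCosh_pos h0.le h1 hc
      have hl : Real.log (certPoly (meanLikelihood alg θ₀ v t p) (Real.exp (-energy alg v t p)) /
          (119 / 20)) = heatCert (energy alg v t p) (score alg θ₀ v t p) - energy alg v t p -
            Real.log (119 / 20) := by
        rw [e, Real.log_div (mul_pos (Real.exp_pos _) hp).ne' (by norm_num),
          Real.log_mul (Real.exp_ne_zero _) hp.ne', Real.log_exp, heatCert]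
        ring
      rw [hl]
    · rw [hqs, meanLikelihood, mul_pow]
      exact le_mul_of_one_le_right (sq_nonneg _) (one_le_pow₀ hc)
  have J1 : Integrable (fun p => heatCert (energy alg v t p) (score alg θ₀ v t p) -
      energy alg v t p) (interactionLaw alg θ₀ t) := i1.sub i2
  have J2 : Integrable (fun p => heatCert (energy alg v t p) (score alg θ₀ v t p) -
      energy alg v t p - Real.log (119 / 20)) (interactionLaw alg θ₀ t) :=
    J1.sub (integrable_const _)
  have J3 : Integrable (fun p => 1363 / 2000 + 11 / 100 * (heatCert (energy alg v t p)
      (score alg θ₀ v t p) - energy alg v t p - Real.log (119 / 20)))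
      (interactionLaw alg θ₀ t) := (integrable_const _).add (J2.const_mul _)
  refine le_trans ?_ (integral_mono (J3.sub (i3.div_const 100)) iR key)
  rw [integral_sub' J3 (i3.div_const 100), integral_add (integrable_const _) (J2.const_mul _),
    integral_const_mul, integral_sub J1 (integrable_const _), integral_sub i1 i2,
    integral_div (100 : ℝ) (meanLikelihood alg θ₀ v t), integral_meanLikelihood]
  simp only [integral_const, probReal_univ, smul_eq_mul, one_mul]
  have := log_le_integral_heatCert alg θ₀ v t
  linarith

/-- Complete the square in `u`: the minimiser is the posterior mean `ρ (Lp - Lm) / 2 / (1 + C)`, and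
`C² - ((Lp - Lm) / 2)² = Lp * Lm = q`. -/
theorem bayesRisk_le {Lp Lm C q u ρ : ℝ} (hLp : 0 < Lp) (hLm : 0 < Lm) (hC : C = (Lp + Lm) / 2)
    (hq : q = Lp * Lm) :
    ρ ^ 2 * ((C + q) / (1 + C)) ≤ Lp * (u - ρ) ^ 2 / 2 + Lm * (u + ρ) ^ 2 / 2 + u ^ 2 := by
  have hC0 : 0 < C := by rw [hC]; linarith
  rw [mul_div_assoc', div_le_iff₀ (by linarith)]
  have : 0 ≤ ((1 + C) * u - ρ * ((Lp - Lm) / 2)) ^ 2 := sq_nonneg _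
  subst hC hq
  nlinarith

theorem integrable_sq_likelihood (alg : Algorithm m Ω) (θ₀ v e : EuclideanSpace ℝ (Fin m))
    (t : ℕ) (ρ : ℝ) :
    Integrable (fun p => Real.exp (score alg θ₀ v t p - energy alg v t p / 2) *
      (inner ℝ (alg.action t p.1 p.2) e - ρ) ^ 2) (interactionLaw alg θ₀ t) := by
  refine (integrable_likelihood alg θ₀ v t).mul_bdd (c := (‖e‖ + |ρ|) ^ 2)
    (((measurable_inner_action alg e t).sub_const ρ).pow_const 2).aestronglyMeasurable
    (Filter.Eventually.of_forall fun p => ?_)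
  rw [Real.norm_eq_abs, abs_of_nonneg (sq_nonneg _), ← sq_abs]
  have := (abs_sub (inner ℝ (alg.action t p.1 p.2) e) ρ).trans
    (add_le_add_left (abs_inner_action_le alg e t p.1 p.2) _)
  gcongr

/-- Two opposite alternatives cannot both be estimated well at little cost under the null. -/
theorem two_point_risk (alg : Algorithm m Ω) (θ₀ v e : EuclideanSpace ℝ (Fin m)) (t : ℕ)
    (ρ : ℝ) :
    ρ ^ 2 * (1343 / 2000 - 11 / 100 * ∫ p, energy alg v t p ∂(interactionLaw alg θ₀ t)) ≤
      (∫ p, (inner ℝ (alg.action t p.1 p.2) e - ρ) ^ 2 ∂(interactionLaw alg (θ₀ + v) t)) / 2 +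
      (∫ p, (inner ℝ (alg.action t p.1 p.2) e + ρ) ^ 2 ∂(interactionLaw alg (θ₀ - v) t)) / 2 +
      ∫ p, (inner ℝ (alg.action t p.1 p.2) e) ^ 2 ∂(interactionLaw alg θ₀ t) := by
  have h1 := mul_le_mul_of_nonneg_left (le_integral_bayesRisk alg θ₀ v t) (sq_nonneg ρ)
  refine h1.trans ?_
  have ip := integrable_sq_likelihood alg θ₀ v e t ρ
  have im := integrable_sq_likelihood alg θ₀ (-v) e t (-ρ)
  have i0 := integrable_inner_action_sq alg θ₀ e t
  simp only [sub_neg_eq_add] at im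
  rw [sub_eq_add_neg θ₀ v, integral_interactionLaw_add, integral_interactionLaw_add]
  have J := (ip.div_const 2).add (im.div_const 2)
  rw [← integral_const_mul, ← integral_div, ← integral_div, ← integral_add'
    (ip.div_const 2) (im.div_const 2), ← integral_add' J i0]
  refine integral_mono_of_nonneg (Filter.Eventually.of_forall fun p => ?_)
    (((ip.div_const 2).add (im.div_const 2)).add i0) (Filter.Eventually.of_forall fun p => ?_)
  · have : 0 < meanLikelihood alg θ₀ v t p := mul_pos (Real.exp_pos _) (Real.cosh_pos _)
    have := Real.exp_pos (-energy alg v t p)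
    simp only [Pi.zero_apply]
    positivity
  · refine bayesRisk_le (Real.exp_pos _) (Real.exp_pos _) (meanLikelihood_eq alg θ₀ v t p) ?_
    rw [← Real.exp_add, score_neg, energy_neg]
    congr 1
    ring

/-! ### Geometry of the unit ball near the hint. -/

section Geometry

variable {E : Type*} [NormedAddCommGroup E] [InnerProductSpace ℝ E]

theorem norm_smul_add_smul {h e : E} (hh : ‖h‖ = 1) (he : ‖e‖ = 1) (ho : inner ℝ h e = 0)
    {r : ℝ} (hr : 0 ≤ r) (σ : ℝ) : ‖r • h + (r * σ) • e‖ = r * √(1 + σ ^ 2) := by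
  have h1 : ‖r • h + (r * σ) • e‖ ^ 2 = r ^ 2 * (1 + σ ^ 2) := by
    rw [norm_add_sq_real, norm_smul, norm_smul, hh, he, inner_smul_left, inner_smul_right, ho,
      Real.norm_eq_abs, Real.norm_eq_abs, mul_one, mul_one, sq_abs, sq_abs]
    simp only [mul_zero, add_zero]
    ring
  rw [← Real.sqrt_sq (norm_nonneg _), h1, Real.sqrt_mul (sq_nonneg r), Real.sqrt_sq hr]

theorem one_add_half_sub_le_sqrt {x : ℝ} (hx : 0 ≤ x) : 1 + x / 2 - x ^ 2 / 8 ≤ √(1 + x) := by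
  rcases le_total x 8 with h | h
  · refine Real.le_sqrt_of_sq_le ?_
    nlinarith [mul_nonneg (pow_nonneg hx 3) (sub_nonneg.2 h)]
  · refine le_trans ?_ (Real.sqrt_nonneg _)
    nlinarith

theorem inner_sq_add_inner_sq_le {h e a : E} (hh : ‖h‖ = 1) (he : ‖e‖ = 1)
    (ho : inner ℝ h e = 0) (ha : ‖a‖ ≤ 1) :
    (inner ℝ h a : ℝ) ^ 2 + (inner ℝ a e : ℝ) ^ 2 ≤ 1 := by
  have h1 := real_inner_self_nonneg (x := a - (inner ℝ h a : ℝ) • h - (inner ℝ a e : ℝ) • e)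
  have h2 : (inner ℝ h h : ℝ) = 1 := by rw [real_inner_self_eq_norm_sq, hh, one_pow]
  have h3 : (inner ℝ e e : ℝ) = 1 := by rw [real_inner_self_eq_norm_sq, he, one_pow]
  have h4 : (inner ℝ a a : ℝ) ≤ 1 := by
    rw [real_inner_self_eq_norm_sq]
    exact pow_le_one₀ (norm_nonneg _) ha
  have h5 : (inner ℝ e h : ℝ) = 0 := by rw [real_inner_comm, ho]
  simp only [inner_sub_left, inner_sub_right, inner_smul_left, inner_smul_right, h2, h3, h5, ho,
    real_inner_comm h a, real_inner_comm a e, RCLike.conj_to_real] at h1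
  nlinarith

/-- Pointwise regret of an action, for a parameter at angle about `σ` from `h`. -/
theorem le_norm_sub_inner {h e a : E} (hh : ‖h‖ = 1) (he : ‖e‖ = 1) (ho : inner ℝ h e = 0)
    (ha : ‖a‖ ≤ 1) {r : ℝ} (hr : 0 ≤ r) (σ : ℝ) :
    r / 2 * (inner ℝ a e - σ) ^ 2 - r * σ ^ 4 / 8 ≤
      ‖r • h + (r * σ) • e‖ - inner ℝ (r • h + (r * σ) • e) a := by
  have h1 := inner_sq_add_inner_sq_le hh he ho ha
  have h2 := one_add_half_sub_le_sqrt (sq_nonneg σ)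
  have h3 : (inner ℝ h a : ℝ) ≤ 1 - (inner ℝ a e : ℝ) ^ 2 / 2 := by
    nlinarith [sq_nonneg ((inner ℝ h a : ℝ) - 1)]
  rw [norm_smul_add_smul hh he ho hr, inner_add_left, real_inner_smul_left, real_inner_smul_left,
    real_inner_comm a e]
  nlinarith [mul_le_mul_of_nonneg_left h2 hr, mul_le_mul_of_nonneg_left h3 hr]

end Geometry

/-! ### From estimation risk to regret. -/

theorem integrable_inner_action (alg : Algorithm m Ω) (θ v : EuclideanSpace ℝ (Fin m))
    (t : ℕ) : Integrable (fun p => (inner ℝ v (alg.action t p.1 p.2) : ℝ))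
      (interactionLaw alg θ t) := by
  simp only [real_inner_comm (alg.action t _ _) v]
  exact Integrable.of_bound (measurable_inner_action alg v t).aestronglyMeasurable
    ‖v‖ (Filter.Eventually.of_forall fun p => abs_inner_action_le alg v t p.1 p.2)

theorem expectedRegret_eq (alg : Algorithm m Ω) (θ : EuclideanSpace ℝ (Fin m)) (T : ℕ) :
    expectedRegret alg θ T = ∑ t ∈ Finset.range T,
      ∫ p, (‖θ‖ - inner ℝ θ (alg.action t p.1 p.2)) ∂(interactionLaw alg θ t) := by
  have h : (inner ℝ θ (optimalAction θ) : ℝ) = ‖θ‖ := by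
    rw [optimalAction, real_inner_smul_right, real_inner_self_eq_norm_sq, sq, ← mul_assoc]
    rcases eq_or_ne ‖θ‖ 0 with h0 | h0
    · simp [h0]
    · rw [inv_mul_cancel₀ h0, one_mul]
  simp only [expectedRegret, integral_regretAgainst, inner_sub_right, h]

theorem expectedHintRegret_smul (alg : Algorithm m Ω) {h : EuclideanSpace ℝ (Fin m)}
    (hh : ‖h‖ = 1) (r : ℝ) (T : ℕ) :
    expectedHintRegret alg h (r • h) T = r * ∑ t ∈ Finset.range T,
      ∫ p, (1 - inner ℝ h (alg.action t p.1 p.2)) ∂(interactionLaw alg (r • h) t) := by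
  rw [expectedHintRegret, integral_regretAgainst, Finset.mul_sum]
  refine Finset.sum_congr rfl fun t _ => ?_
  rw [← integral_const_mul]
  simp only [real_inner_smul_left, inner_sub_right, real_inner_self_eq_norm_sq, hh, one_pow,
    mul_sub]

/-- At a nonnegative multiple of the hint, the hint is itself optimal. Hint regret there is
therefore both a regret lower bound and the exploration budget. -/
theorem expectedRegret_smul (alg : Algorithm m Ω) {h : EuclideanSpace ℝ (Fin m)}
    (hh : ‖h‖ = 1) {r : ℝ} (hr : 0 ≤ r) (T : ℕ) :
    expectedRegret alg (r • h) T = expectedHintRegret alg h (r • h) T := by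
  rw [expectedHintRegret_smul alg hh, expectedRegret_eq, Finset.mul_sum]
  refine Finset.sum_congr rfl fun t _ => ?_
  rw [← integral_const_mul]
  simp only [real_inner_smul_left, norm_smul, hh, Real.norm_of_nonneg hr, mul_sub]

theorem inner_action_le_one (alg : Algorithm m Ω) {h : EuclideanSpace ℝ (Fin m)}
    (hh : ‖h‖ = 1) (t : ℕ) (ω : Ω) (y : Fin t → ℝ) :
    (inner ℝ h (alg.action t ω y) : ℝ) ≤ 1 := by
  have := real_inner_le_norm h (alg.action t ω y)
  rw [hh, one_mul] at this
  exact this.trans (alg.norm_action_le t ω y)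

theorem sum_integral_one_sub_nonneg (alg : Algorithm m Ω) {h : EuclideanSpace ℝ (Fin m)}
    (hh : ‖h‖ = 1) (θ : EuclideanSpace ℝ (Fin m)) (T : ℕ) :
    0 ≤ ∑ t ∈ Finset.range T,
      ∫ p, (1 - inner ℝ h (alg.action t p.1 p.2)) ∂(interactionLaw alg θ t) :=
  Finset.sum_nonneg fun t _ => integral_nonneg fun p =>
    sub_nonneg.2 (inner_action_le_one alg hh t p.1 p.2)

theorem le_expectedRegret (alg : Algorithm m Ω) {h e : EuclideanSpace ℝ (Fin m)}
    (hh : ‖h‖ = 1) (he : ‖e‖ = 1) (ho : inner ℝ h e = 0) {r : ℝ} (hr : 0 ≤ r) (σ : ℝ) (T : ℕ) :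
    ∑ t ∈ Finset.range T, (r / 2 * ∫ p, (inner ℝ (alg.action t p.1 p.2) e - σ) ^ 2
      ∂(interactionLaw alg (r • h + (r * σ) • e) t) - r * σ ^ 4 / 8) ≤
      expectedRegret alg (r • h + (r * σ) • e) T := by
  rw [expectedRegret_eq]
  refine Finset.sum_le_sum fun t _ => ?_
  set θ := r • h + (r * σ) • e
  have i1 : Integrable (fun p => r / 2 * (inner ℝ (alg.action t p.1 p.2) e - σ) ^ 2)
      (interactionLaw alg θ t) := by
    refine Integrable.const_mul (Integrable.of_bound (((measurable_inner_action alg e t).sub_const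
      σ).pow_const 2).aestronglyMeasurable ((‖e‖ + |σ|) ^ 2)
      (Filter.Eventually.of_forall fun p => ?_)) _
    rw [Real.norm_eq_abs, abs_of_nonneg (sq_nonneg _), ← sq_abs]
    have := (abs_sub (inner ℝ (alg.action t p.1 p.2) e) σ).trans
      (add_le_add_left (abs_inner_action_le alg e t p.1 p.2) _)
    gcongr
  have i2 : Integrable (fun p => ‖θ‖ - inner ℝ θ (alg.action t p.1 p.2))
      (interactionLaw alg θ t) :=
    (integrable_const _).sub (integrable_inner_action alg θ θ t)
  have h1 : ∫ p, (r / 2 * (inner ℝ (alg.action t p.1 p.2) e - σ) ^ 2 - r * σ ^ 4 / 8)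
      ∂(interactionLaw alg θ t) ≤ _ := integral_mono (i1.sub (integrable_const _)) i2 fun p =>
    le_norm_sub_inner hh he ho (alg.norm_action_le t p.1 p.2) hr σ
  refine le_trans (le_of_eq ?_) h1
  rw [integral_sub i1 (integrable_const _), integral_const_mul]
  simp

/-- Some direction orthogonal to the hint is explored at most an average amount. -/
theorem exists_direction {d : ℕ} (hd : 1 ≤ d) (alg : Algorithm (d + 1) Ω)
    {h : EuclideanSpace ℝ (Fin (d + 1))} (hh : ‖h‖ = 1) {r : ℝ} (hr : 0 ≤ r) (T : ℕ) :
    ∃ e : EuclideanSpace ℝ (Fin (d + 1)), ‖e‖ = 1 ∧ inner ℝ h e = 0 ∧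
      r / 2 * ∑ t ∈ Finset.range T, ∫ p, (inner ℝ (alg.action t p.1 p.2) e : ℝ) ^ 2
        ∂(interactionLaw alg (r • h) t) ≤ expectedHintRegret alg h (r • h) T / d := by
  obtain ⟨b, hb⟩ := Orthonormal.exists_orthonormalBasis_extension_of_card_eq
    (𝕜 := ℝ) (E := EuclideanSpace ℝ (Fin (d + 1))) (ι := Fin (d + 1)) (v := fun _ => h)
    (s := {0}) (by simp) (by
      rw [orthonormal_iff_ite]
      rintro ⟨i, hi⟩ ⟨j, hj⟩
      have : i = j := by rw [hi, hj]
      simp [this, hh])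
  have hb0 : b 0 = h := hb 0 rfl
  set f : Fin d → ℝ := fun i => r / 2 * ∑ t ∈ Finset.range T,
    ∫ p, (inner ℝ (alg.action t p.1 p.2) (b i.succ) : ℝ) ^ 2 ∂(interactionLaw alg (r • h) t)
  -- Parseval leaves at most `1 - ⟪h, a⟫²` for the orthogonal directions, and `1 - x² ≤ 2 (1 - x)`.
  have hpt : ∀ a : EuclideanSpace ℝ (Fin (d + 1)), ‖a‖ ≤ 1 →
      ∑ i : Fin d, (inner ℝ a (b i.succ) : ℝ) ^ 2 ≤ 2 * (1 - inner ℝ h a) := by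
    intro a ha
    have h1 := b.sum_sq_norm_inner_left a
    simp only [Fin.sum_univ_succ, hb0, Real.norm_eq_abs, sq_abs] at h1
    have h2 : ‖a‖ ^ 2 ≤ 1 := pow_le_one₀ (norm_nonneg _) ha
    have h3 := real_inner_comm a h
    nlinarith [sq_nonneg ((inner ℝ h a : ℝ) - 1)]
  have hsum : ∑ i, f i ≤ ∑ _i : Fin d, expectedHintRegret alg h (r • h) T / d := by
    have hd0 : (d : ℝ) ≠ 0 := by positivity
    rw [Finset.sum_const, Finset.card_univ, Fintype.card_fin, nsmul_eq_mul, mul_div_cancel₀ _ hd0,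
      expectedHintRegret_smul alg hh]
    simp only [f]
    rw [← Finset.mul_sum, Finset.sum_comm, div_mul_eq_mul_div, mul_div_assoc]
    refine mul_le_mul_of_nonneg_left ?_ hr
    rw [Finset.sum_div]
    refine Finset.sum_le_sum fun t _ => ?_
    have hi := fun i : Fin d => integrable_inner_action_sq alg (r • h) (b i.succ) t
    rw [← integral_finsetSum _ fun i _ => hi i, div_le_iff₀' two_pos, ← integral_const_mul]
    refine integral_mono (integrable_finsetSum _ fun i _ => hi i)
      (((integrable_const _).sub (integrable_inner_action alg _ h t)).const_mul _) fun p =>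
      hpt _ (alg.norm_action_le t p.1 p.2)
  have : Nonempty (Fin d) := ⟨⟨0, hd⟩⟩
  obtain ⟨i, -, hi⟩ := Finset.exists_le_of_sum_le Finset.univ_nonempty hsum
  refine ⟨b i.succ, b.norm_eq_one _, ?_, hi⟩
  rw [← hb0]
  exact b.inner_eq_zero (Fin.succ_ne_zero i).symm

/-- Two opposite perturbations of `r • h` in a little explored direction: one of them is costly. -/
theorem le_max_expectedRegret (alg : Algorithm m Ω) {h e : EuclideanSpace ℝ (Fin m)}
    (hh : ‖h‖ = 1) (he : ‖e‖ = 1) (ho : inner ℝ h e = 0) {r B : ℝ} (hr : 0 ≤ r) (T : ℕ)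
    (hB : r / 2 * ∑ t ∈ Finset.range T, ∫ p, (inner ℝ (alg.action t p.1 p.2) e : ℝ) ^ 2
        ∂(interactionLaw alg (r • h) t) ≤ B) (ρ : ℝ) :
    T * (r * ρ ^ 2) / 2 * (1343 / 2000 - ρ ^ 2 / 4 - 11 / 50 * (r * ρ ^ 2) * B) - B ≤
      max (expectedRegret alg (r • h + (r * ρ) • e) T)
        (expectedRegret alg (r • h + (r * -ρ) • e) T) := by
  have hp := le_expectedRegret alg hh he ho hr ρ T
  have hm := le_expectedRegret alg hh he ho hr (-ρ) T
  set Gp := expectedRegret alg (r • h + (r * ρ) • e) T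
  set Gm := expectedRegret alg (r • h + (r * -ρ) • e) T
  set u : ℕ → ℝ := fun t => ∫ p, (inner ℝ (alg.action t p.1 p.2) e : ℝ) ^ 2
        ∂(interactionLaw alg (r • h) t) with hu
  have hu0 : ∀ t, 0 ≤ u t := fun t => integral_nonneg fun p => sq_nonneg _
  have henergy : ∀ t ∈ Finset.range T, r / 2 * (ρ ^ 2 * (11 / 100 *
      ∫ p, energy alg ((r * ρ) • e) t p ∂(interactionLaw alg (r • h) t))) ≤
        r * ρ ^ 2 / 2 * (11 / 50 * (r * ρ ^ 2) * B) := by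
    intro t ht
    have h1 : ∫ p, energy alg ((r * ρ) • e) t p ∂(interactionLaw alg (r • h) t) =
        (r * ρ) ^ 2 * ∑ s ∈ Finset.range t, u s := by
      rw [integral_energy, Finset.mul_sum]
      refine Finset.sum_congr rfl fun s _ => ?_
      rw [hu, ← integral_const_mul]
      simp only [real_inner_smul_right, mul_pow]
    have h2 : ∑ s ∈ Finset.range t, u s ≤ ∑ s ∈ Finset.range T, u s :=
      Finset.sum_le_sum_of_subset_of_nonneg
        (Finset.range_mono (Finset.mem_range.1 ht).le) fun s _ _ => hu0 s
    have h3 : r / 2 * ∑ s ∈ Finset.range t, u s ≤ B :=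
      (mul_le_mul_of_nonneg_left h2 (by positivity)).trans hB
    rw [h1]
    have h4 : 0 ≤ r * ρ ^ 2 * (11 / 100) * (r * ρ ^ 2) := by positivity
    calc _ = r * ρ ^ 2 * (11 / 100) * (r * ρ ^ 2) * (r / 2 * ∑ s ∈ Finset.range t, u s) := by ring
      _ ≤ r * ρ ^ 2 * (11 / 100) * (r * ρ ^ 2) * B := mul_le_mul_of_nonneg_left h3 h4
      _ = _ := by ring
  -- The mean of the two regrets supplies the risk at `±ρ`. The risk at the null, `r / 2 * u t`, is
  -- moved to the left; its sum over the rounds is at most `B`.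
  have hround : ∑ t ∈ Finset.range T, (r * ρ ^ 2 / 2 * (1343 / 2000 - ρ ^ 2 / 4 -
      11 / 50 * (r * ρ ^ 2) * B) - r / 2 * u t) ≤ Gp / 2 + Gm / 2 := by
    refine le_trans ?_ (add_le_add (div_le_div_of_nonneg_right hp two_pos.le)
      (div_le_div_of_nonneg_right hm two_pos.le))
    rw [Finset.sum_div, Finset.sum_div, ← Finset.sum_add_distrib]
    refine Finset.sum_le_sum fun t ht => ?_
    have h1 := two_point_risk alg (r • h) ((r * ρ) • e) e t ρ
    have h2 := henergy t ht
    have h3 : r • h - (r * ρ) • e = r • h + (r * -ρ) • e := by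
      rw [mul_neg, neg_smul, sub_eq_add_neg]
    rw [h3] at h1
    have h4 := mul_le_mul_of_nonneg_left h1 (by positivity : 0 ≤ r / 2)
    simp only [sub_neg_eq_add, hu]
    nlinarith
  rw [Finset.sum_sub_distrib, Finset.sum_const, Finset.card_range, nsmul_eq_mul,
    ← Finset.mul_sum] at hround
  have h5 := le_max_left Gp Gm
  have h6 := le_max_right Gp Gm
  nlinarith

/-! ### Optimising the perturbation and combining the bounds. -/

theorem exists_scale {r : ℝ} (hr : r = 20000) {d T R₀ R₁ : ℝ} (hd : 0 < d) (hT : 0 ≤ T)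
    (h1 : R₀ ≤ R₁) (h2 : d / 4 ≤ R₁) :
    ∃ ρ : ℝ, ρ ^ 2 ≤ 1 ∧ T * d * (2561 / 2500) / (4 * R₁) - R₀ / d ≤
      T * (r * ρ ^ 2) / 2 * (1343 / 2000 - ρ ^ 2 / 4 - 11 / 50 * (r * ρ ^ 2) * (R₀ / d)) -
        R₀ / d := by
  have hR : 0 < R₁ := by linarith
  set w : ℝ := d / R₁ with hw
  have hw0 : 0 < w := by positivity
  have hw4 : w ≤ 4 := by rw [hw, div_le_iff₀ hR]; linarith
  have hwR : w * (R₀ / d) ≤ 1 := by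
    rw [hw, div_mul_div_comm, mul_comm R₁ d, mul_div_mul_left _ _ hd.ne', div_le_one hR]
    exact h1
  -- With `y = r * ρ ^ 2` and `R₀ / d` bounded by `1 / w`, this `y` maximises `y * (3357/5000 -
  -- 11/50 * y / w)`. The large `r` and `w ≤ 4` make the bias `ρ ^ 2 / 4` smaller than `1343/2000 -
  -- 3357/5000`. The optimum is at least `2561/10000 * T * w`, just above `T * w / 4`.
  refine ⟨√(3357 / 2200 * w / r), ?_, ?_⟩
  · rw [Real.sq_sqrt (by subst hr; positivity), hr]
    linarith
  rw [Real.sq_sqrt (by subst hr; positivity), mul_div_cancel₀ _ (by rw [hr]; norm_num)]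
  have e1 : T * d * (2561 / 2500) / (4 * R₁) = T * w * (2561 / 10000) := by
    rw [hw]; field_simp; ring
  rw [e1]
  gcongr ?_ - _
  have h3 : 3357 / 5000 - 3357 / 10000 ≤ 1343 / 2000 - 3357 / 2200 * w / r / 4 -
      11 / 50 * (3357 / 2200 * w) * (R₀ / d) := by
    rw [hr]; nlinarith
  have h4 := mul_le_mul_of_nonneg_left h3 (by positivity : 0 ≤ T * (3357 / 2200 * w) / 2)
  have h5 : 0 ≤ T * w := by positivity
  linarith

/-- Combines the lower bound `R` at the null with the two-alternative bound at a budget `R₁` that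
may exceed `R`. Raising `R₁` weakens the latter but keeps the perturbation small. The variable `x`
stands for every fraction that the final statement requires. -/
theorem exists_level {d T R : ℝ} (hd : d = 1 ∨ 2 ≤ d) (hT : 1 ≤ T) (hR : 0 ≤ R) :
    ∃ R₁, R ≤ R₁ ∧ d / 4 ≤ R₁ ∧ ∀ M x : ℝ, R ≤ M →
      T * d * (2561 / 2500) / (4 * R₁) - R / d ≤ M → 0 ≤ x → x ≤ 1 →
      x * R ≤ max (d - 1) (d / 100) → 1 / 4 + T / 4 * x ≤ M := by
  rcases hd with rfl | hd
  -- For `d = 1` the entry `d - 1` vanishes; `d / 100` is what permits the fraction needed for the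
  -- product bound.
  · have hk : max ((1 : ℝ) - 1) (1 / 100) = 1 / 100 := by norm_num
    simp only [hk, mul_one, div_one]
    rcases le_total R (1 / 3) with h | h
    · refine ⟨1 / 3, h, by norm_num, fun M x h1 h2 h3 h4 h5 => ?_⟩
      by_contra! h6
      have e : T * (2561 / 2500) / (4 * (1 / 3)) = T * (7683 / 10000) := by ring
      rw [e] at h2
      have hy : T * x ≤ T := mul_le_of_le_one_right (by linarith) h4
      have hx : 1 / 2 < x := by
        by_contra! hx
        have : T * x ≤ T * (1 / 2) := by gcongr
        linarith
      have hR2 : 1 / 2 * R ≤ x * R := by gcongr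
      linarith
    · refine ⟨R, le_rfl, by linarith, fun M x h1 h2 h3 h4 h5 => ?_⟩
      by_contra! h6
      have hy : 0 ≤ T * x := by positivity
      have h7 : 100 * (T * x) ≤ T / R := by
        rw [le_div_iff₀ (by linarith)]
        nlinarith
      have h8 : T * (2561 / 2500) / (4 * R) = 2561 / 10000 * (T / R) := by
        field_simp; ring
      rw [h8] at h2
      linarith
  · have hk : max (d - 1) (d / 100) = d - 1 := max_eq_left (by linarith)
    rw [hk]
    -- The critical case is `R = d - 1`, `T = 4 * R - 1`. With `κ = 2561/2500` the claim reads `(d -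
    -- 2)² ≤ (κ - 1) d² (4 d - 5)`: it fails for `κ = 1` and `d > 2`, and is nearly tight around `d
    -- = 4.84`.
    have hcub : 4 * (d - 1) ^ 2 * (d + 1) ≤ d ^ 2 * (2561 / 2500) * (4 * d - 5) := by
      nlinarith [mul_nonneg (sub_nonneg.2 hd) (sq_nonneg (d - 484 / 100)),
        sq_nonneg (d - 484 / 100)]
    have hd0 : 0 < d := by linarith
    rcases lt_or_ge (d - 1) R with h | h
    · have hRpos : 0 < R := by linarith
      refine ⟨R, le_rfl, by linarith, fun M x h1 h2 h3 h4 h5 => ?_⟩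
      by_contra! h6
      have a1 : R * (4 * R - 1) < T * (d - 1) := by nlinarith
      have a2 : T * (d * (2561 / 2500) - (d - 1)) < R * (1 + 4 * (R / d)) := by
        have : T * d * (2561 / 2500) / (4 * R) < 1 / 4 + T / 4 * x + R / d := by linarith
        rw [div_lt_iff₀ (by positivity)] at this
        nlinarith
      have a3 : (d - 1) * (1 + 4 * (R / d)) ≤ (d * (2561 / 2500) - (d - 1)) * (4 * R - 1) := by
        have : d * ((d - 1) * (1 + 4 * (R / d))) ≤
            d * ((d * (2561 / 2500) - (d - 1)) * (4 * R - 1)) := by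
          have e : d * ((d - 1) * (1 + 4 * (R / d))) = (d - 1) * (d + 4 * R) := by
            field_simp
          rw [e]
          nlinarith
        exact le_of_mul_le_mul_left this hd0
      have a4 : 0 < d * (2561 / 2500) - (d - 1) := by linarith
      nlinarith [mul_lt_mul_of_pos_left a1 a4, mul_lt_mul_of_pos_left a2 (by linarith : 0 < d - 1),
        mul_le_mul_of_nonneg_left a3 hR]
    · by_cases hRT : 4 * R ≤ 1 + T
      · have hRd : R / d ≤ (1 + T) / 8 := by
          rw [div_le_iff₀ hd0]; nlinarith
        have hRd0 : 0 ≤ R / d := by positivity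
        have hden : 0 < 1 + T + 4 * (R / d) := by positivity
        -- The budget at which the second lower bound equals `(1 + T) / 4`, which covers all `x ≤
        -- 1`.
        refine ⟨T * d * (2561 / 2500) / (1 + T + 4 * (R / d)), ?_, ?_, fun M x h1 h2 h3 h4 _ => ?_⟩
        · rw [le_div_iff₀ hden]
          have : d * (R * (1 + T + 4 * (R / d))) ≤ d * (T * d * (2561 / 2500)) := by
            have e : d * (R * (1 + T + 4 * (R / d))) = R * (d * (1 + T) + 4 * R) := by
              field_simp
            rw [e]
            rcases le_total R (1 / 2) with hR2 | hR2
            · have : R * (d * (1 + T) + 4 * R) ≤ 1 / 2 * (d * (1 + T) + 4 * (1 / 2)) := by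
                gcongr
              nlinarith
            · have q1 : 0 ≤ d ^ 2 * (2561 / 2500) - (d + 1) := by nlinarith
              -- The second factor is concave in `R`, so it suffices to interpolate between the
              -- endpoints `R = 1/2` (`q1`) and `R = d - 1` (`hcub`); `d - 3/2` is the length of
              -- that interval.
              have q2 : 0 ≤ (d - 3 / 2) *
                  (d ^ 2 * (2561 / 2500) * (4 * R - 1) - 4 * R ^ 2 * (d + 1)) := by
                have := mul_nonneg (sub_nonneg.2 h) q1
                have := mul_nonneg (sub_nonneg.2 hR2) (sub_nonneg.2 hcub)
                have := mul_nonneg (mul_nonneg (mul_nonneg (sub_nonneg.2 hR2)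
                  (sub_nonneg.2 h)) (by linarith : 0 ≤ d - 3 / 2)) (by linarith : 0 ≤ d + 1)
                linarith
              have q3 := nonneg_of_mul_nonneg_right q2 (by linarith)
              have q4 : 0 ≤ d * (d * (2561 / 2500) - R) * (1 + T - 4 * R) :=
                mul_nonneg (mul_nonneg hd0.le (by linarith)) (by linarith)
              linarith
          exact le_of_mul_le_mul_left this hd0
        · rw [le_div_iff₀ hden]
          nlinarith
        · have e : T * d * (2561 / 2500) / (4 * (T * d * (2561 / 2500) /
              (1 + T + 4 * (R / d)))) = (1 + T + 4 * (R / d)) / 4 := by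
            field_simp
          rw [e] at h2
          nlinarith
      · refine ⟨max R (d / 4), le_max_left _ _, le_max_right _ _, fun M x h1 _ h3 h4 _ => ?_⟩
        nlinarith

/-! ### Families of parameters and the final bound. -/

/-- Without regret against `h` in the instance `r • h`, the learner always plays `h`, also in the
instance `-(r • h)`. -/
theorem expectedRegret_neg_smul (alg : Algorithm m Ω) {h : EuclideanSpace ℝ (Fin m)}
    (hh : ‖h‖ = 1) {r : ℝ} (hr : 0 < r) (T : ℕ)
    (h0 : expectedHintRegret alg h (r • h) T = 0) :
    expectedRegret alg (-(r • h)) T = T * (2 * r) := by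
  have hnn : ∀ t ∈ Finset.range T, 0 ≤
      ∫ p, (1 - inner ℝ h (alg.action t p.1 p.2)) ∂(interactionLaw alg (r • h) t) :=
    fun t _ => integral_nonneg fun p => sub_nonneg.2 (inner_action_le_one alg hh t p.1 p.2)
  rw [expectedHintRegret_smul alg hh, mul_eq_zero, or_iff_right hr.ne',
    Finset.sum_eq_zero_iff_of_nonneg hnn] at h0
  rw [expectedRegret_eq]
  suffices key : ∀ t ∈ Finset.range T,
      ∫ p, (‖-(r • h)‖ - inner ℝ (-(r • h)) (alg.action t p.1 p.2))
        ∂(interactionLaw alg (-(r • h)) t) = 2 * r by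
    rw [Finset.sum_congr rfl key]
    simp
  intro t ht
  have hi : Integrable (fun p => 1 - inner ℝ h (alg.action t p.1 p.2))
      (interactionLaw alg (r • h) t) :=
    (integrable_const _).sub (integrable_inner_action alg _ h t)
  have hp : ∀ p : Ω × (Fin t → ℝ), 0 ≤ 1 - inner ℝ h (alg.action t p.1 p.2) := fun p =>
    sub_nonneg.2 (inner_action_le_one alg hh t p.1 p.2)
  have h1 := (integral_eq_zero_iff_of_nonneg hp hi).1 (h0 t ht)
  -- The laws have a likelihood ratio, so the almost sure identity `⟪h, a_t⟫ = 1` passes to the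
  -- opposite instance.
  have hac : interactionLaw alg (-(r • h)) t ≪ interactionLaw alg (r • h) t := by
    have e : -(r • h) = r • h + -((2 * r) • h) := by module
    rw [e, interactionLaw_add]
    exact withDensity_absolutelyContinuous _ _
  have h2 := hac.ae_eq h1
  have h3 : ∫ p, (‖-(r • h)‖ - inner ℝ (-(r • h)) (alg.action t p.1 p.2))
      ∂(interactionLaw alg (-(r • h)) t) = ∫ _, 2 * r ∂(interactionLaw alg (-(r • h)) t) := by
    refine integral_congr_ae ?_
    filter_upwards [h2] with p hp
    simp only [Pi.zero_apply] at hp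
    rw [norm_neg, norm_smul, hh, Real.norm_of_nonneg hr.le, inner_neg_left, real_inner_smul_left,
      ← sub_eq_zero.1 hp]
    ring
  rw [h3]
  simp

theorem exists_isGreatest_image {α : Type*} (F : α → ℝ) (s : Finset α) {a : α} (ha : a ∈ s) :
    ∃ R, IsGreatest (F '' (s : Set α)) R ∧ F a ≤ R := by
  obtain ⟨b, hb, hmax⟩ := s.exists_max_image F ⟨a, ha⟩
  refine ⟨F b, ⟨⟨b, hb, rfl⟩, ?_⟩, hmax a ha⟩
  rintro _ ⟨c, hc, rfl⟩
  exact hmax c hc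

/-- The lower bound when the hint is the only direction. -/
theorem exists_family_of_line {r : ℝ} (hr : 1 ≤ r) {T : ℕ} (hT : 1 ≤ T)
    (alg : Algorithm m Ω) {h : EuclideanSpace ℝ (Fin m)} (hh : ‖h‖ = 1) :
    ∃ (Θ : Finset (EuclideanSpace ℝ (Fin m))) (Rh : ℝ),
      (∀ θ ∈ Θ, ‖θ‖ = r) ∧
      IsGreatest ((fun θ => expectedHintRegret alg h θ T) '' (Θ : Set _)) Rh ∧ 0 ≤ Rh ∧
      ∃ θ ∈ Θ, 0 ≤ expectedRegret alg θ T ∧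
        (0 < Rh → 1 / 4 + (T : ℝ) / 4 * min 1 (-1 / Rh) ≤ expectedRegret alg θ T) ∧
        (Rh = 0 → 1 / 4 + (T : ℝ) / 4 ≤ expectedRegret alg θ T) := by
  classical
  have hr0 : 0 < r := by linarith
  have hT1 : (1 : ℝ) ≤ T := by exact_mod_cast hT
  have hnorm : ‖r • h‖ = r := by rw [norm_smul, hh, Real.norm_of_nonneg hr0.le, mul_one]
  have hF : 0 ≤ expectedHintRegret alg h (r • h) T := by
    rw [expectedHintRegret_smul alg hh]
    exact mul_nonneg hr0.le (sum_integral_one_sub_nonneg alg hh _ T)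
  have hFn : expectedHintRegret alg h (-(r • h)) T ≤ 0 := by
    rw [← neg_smul, expectedHintRegret_smul alg hh]
    exact mul_nonpos_of_nonpos_of_nonneg (by linarith) (sum_integral_one_sub_nonneg alg hh _ T)
  refine ⟨{r • h, -(r • h)}, expectedHintRegret alg h (r • h) T, ?_, ⟨⟨r • h, by simp, rfl⟩, ?_⟩,
    hF, ?_⟩
  · simp [hnorm]
  · rintro _ ⟨θ, hθ, rfl⟩
    simp only [Finset.coe_insert, Finset.coe_singleton, Set.mem_insert_iff,
      Set.mem_singleton_iff] at hθ
    rcases hθ with rfl | rfl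
    · exact le_rfl
    · exact hFn.trans hF
  · rcases hF.eq_or_lt with h0 | h0
    · have hG := expectedRegret_neg_smul alg hh hr0 T h0.symm
      refine ⟨-(r • h), by simp, ?_, fun hlt => absurd h0 hlt.ne, fun _ => ?_⟩ <;> rw [hG]
      · positivity
      · nlinarith
    · refine ⟨r • h, by simp, ?_, fun _ => ?_, fun he => absurd he h0.ne'⟩ <;>
        rw [expectedRegret_smul alg hh hr0.le]
      · exact hF
      set R := expectedHintRegret alg h (r • h) T
      have h1 := min_le_right 1 (-1 / R)
      -- Either the regret `R` already exceeds `1/4` and the added term is nonpositive, or `-1 / R ≤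
      -- -4` and the target is at most `1/4 - T < 0`.
      rcases le_total (1 / 4) R with hR | hR
      · have h2 : -1 / R ≤ 0 := div_nonpos_of_nonpos_of_nonneg (by norm_num) hF
        nlinarith
      · have h2 : -1 / R ≤ -4 := by
          rw [div_le_iff₀ h0]
          linarith
        nlinarith

/-- The lower bound when there are directions orthogonal to the hint. -/
theorem exists_family {r : ℝ} (hr : r = 20000) {d T : ℕ} (hd : 1 ≤ d) (hT : 1 ≤ T)
    (alg : Algorithm (d + 1) Ω) {h : EuclideanSpace ℝ (Fin (d + 1))} (hh : ‖h‖ = 1) :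
    ∃ (Θ : Finset (EuclideanSpace ℝ (Fin (d + 1)))) (Rh : ℝ),
      (∀ θ ∈ Θ, r ≤ ‖θ‖ ∧ ‖θ‖ ≤ 2 * r) ∧
      IsGreatest ((fun θ => expectedHintRegret alg h θ T) '' (Θ : Set _)) Rh ∧ 0 ≤ Rh ∧
      ∃ θ ∈ Θ, ∀ x : ℝ, 0 ≤ x → x ≤ 1 → x * Rh ≤ max ((d : ℝ) - 1) (d / 100) →
        1 / 4 + (T : ℝ) / 4 * x ≤ expectedRegret alg θ T := by
  classical
  have hr0 : 0 ≤ r := by rw [hr]; norm_num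
  have hT1 : (1 : ℝ) ≤ T := by exact_mod_cast hT
  have hd1 : (1 : ℝ) ≤ d := by exact_mod_cast hd
  have hdc : (d : ℝ) = 1 ∨ (2 : ℝ) ≤ d := by
    rcases hd.eq_or_lt with rfl | h2
    · exact Or.inl (by norm_num)
    · exact Or.inr (by exact_mod_cast h2)
  have hR0 : 0 ≤ expectedHintRegret alg h (r • h) T := by
    rw [expectedHintRegret_smul alg hh]
    exact mul_nonneg hr0 (sum_integral_one_sub_nonneg alg hh _ T)
  obtain ⟨e, he, ho, hB⟩ := exists_direction hd alg hh hr0 T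
  obtain ⟨R₁, hR₁, hdR₁, hlevel⟩ := exists_level hdc hT1 hR0
  obtain ⟨ρ, hρ, hscale⟩ := exists_scale hr (T := T) (by linarith) (by linarith) hR₁ hdR₁
  have hmax := hscale.trans (le_max_expectedRegret alg hh he ho hr0 T hB ρ)
  have hnorm : ∀ σ : ℝ, σ ^ 2 ≤ 1 → r ≤ ‖r • h + (r * σ) • e‖ ∧ ‖r • h + (r * σ) • e‖ ≤ 2 * r := by
    intro σ hσ
    rw [norm_smul_add_smul hh he ho hr0, mul_comm 2 r]
    refine ⟨le_mul_of_one_le_right hr0 (Real.one_le_sqrt.2 (by nlinarith)),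
      mul_le_mul_of_nonneg_left (Real.sqrt_le_iff.2 ⟨by norm_num, by linarith⟩) hr0⟩
  let Θ : Finset (EuclideanSpace ℝ (Fin (d + 1))) :=
    {r • h, r • h + (r * ρ) • e, r • h + (r * -ρ) • e}
  obtain ⟨Rh, hRh, hle⟩ := exists_isGreatest_image
    (fun θ => expectedHintRegret alg h θ T) Θ (a := r • h) (by simp [Θ])
  -- The parameter of largest regret serves all claims at once. Of `Rh` only its lower bound by the
  -- hint regret at `r • h` is used.
  obtain ⟨θ, hθ, hθmax⟩ := Θ.exists_max_image (fun θ => expectedRegret alg θ T)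
    ⟨r • h, by simp [Θ]⟩
  refine ⟨Θ, Rh, ?_, hRh, hR0.trans hle, θ, hθ, fun x hx0 hx1 hx => ?_⟩
  · intro θ hθ
    simp only [Θ, Finset.mem_insert, Finset.mem_singleton] at hθ
    rcases hθ with rfl | rfl | rfl
    · simpa using hnorm 0 (by norm_num)
    · exact hnorm ρ hρ
    · exact hnorm (-ρ) (by rwa [neg_sq])
  · refine hlevel _ x ?_ (hmax.trans (max_le (hθmax _ (by simp [Θ])) (hθmax _ (by simp [Θ]))))
      hx0 hx1 ((mul_le_mul_of_nonneg_left hle hx0).trans hx)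
    rw [← expectedRegret_smul alg hh hr0]
    exact hθmax _ (by simp [Θ])

end HintBandit

theorem mainTheorem2 :
    ∃ r₁ r₂ c : ℝ, 0 < r₁ ∧ r₁ ≤ r₂ ∧ 0 < c ∧
      ∀ (d T : ℕ), 1 ≤ T →
      ∀ h : EuclideanSpace ℝ (Fin (d + 1)), ‖h‖ = 1 →
      ∀ (Ω : Type*) [MeasurableSpace Ω] (alg : HintBandit.Algorithm (d + 1) Ω),
      ∃ (Θ : Finset (EuclideanSpace ℝ (Fin (d + 1)))) (Rh : ℝ),
        (∀ θ ∈ Θ, r₁ ≤ ‖θ‖ ∧ ‖θ‖ ≤ r₂) ∧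
        IsGreatest ((fun θ => HintBandit.expectedHintRegret alg h θ T) '' (Θ : Set _)) Rh ∧
        0 ≤ Rh ∧
        ∃ θ ∈ Θ,
          (0 < Rh →
            1 / 4 + (T : ℝ) / 4 * min 1 (((d : ℝ) - 1) / Rh)
              ≤ HintBandit.expectedRegret alg θ T) ∧
          (Rh = 0 → 1 / 4 + (T : ℝ) / 4 ≤ HintBandit.expectedRegret alg θ T) ∧
          ((d : ℝ) ≤ Rh → c * (d * T / Rh) ≤ HintBandit.expectedRegret alg θ T) := by
  refine ⟨20000, 2 * 20000, 1 / 400, by norm_num, by norm_num, by norm_num, ?_⟩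
  intro d T hT h hh Ω _ alg
  rcases Nat.eq_zero_or_pos d with rfl | hd
  · obtain ⟨Θ, Rh, hΘ, hRh, hRh0, θ, hθ, hG, hpos, hzero⟩ :=
      HintBandit.exists_family_of_line (r := 20000) (by norm_num) hT alg hh
    refine ⟨Θ, Rh, fun θ hθ => ?_, hRh, hRh0, θ, hθ, ?_, hzero, ?_⟩
    · rw [hΘ θ hθ]
      norm_num
    · simpa using hpos
    · simpa using fun _ => hG
  · obtain ⟨Θ, Rh, hΘ, hRh, hRh0, θ, hθ, hG⟩ := HintBandit.exists_family rfl hd hT alg hh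
    have hd1 : (1 : ℝ) ≤ d := by exact_mod_cast hd
    refine ⟨Θ, Rh, hΘ, hRh, hRh0, θ, hθ, fun hpos => ?_, fun hzero => ?_, fun hle => ?_⟩
    · refine hG _ (le_min zero_le_one (div_nonneg (by linarith) hRh0)) (min_le_left _ _) ?_
      refine le_trans ?_ (le_max_left _ _)
      exact (mul_le_mul_of_nonneg_right (min_le_right _ _) hRh0).trans_eq
        (div_mul_cancel₀ _ hpos.ne')
    · have := hG 1 zero_le_one le_rfl (by
        rw [hzero, mul_zero]
        exact (by positivity : (0 : ℝ) ≤ d / 100).trans (le_max_right _ _))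
      rwa [mul_one] at this
    · have hpos : 0 < Rh := by linarith
      -- The fraction `d / (100 * Rh)` is admissible by the second entry of the maximum; the factor
      -- `1/4` then gives the constant `1/400`.
      have := hG (d / 100 / Rh) (by positivity) (by rw [div_le_one hpos]; linarith) (by
        rw [div_mul_cancel₀ _ hpos.ne']
        exact le_max_right _ _)
      refine le_trans ?_ this
      have e : (T : ℝ) / 4 * (d / 100 / Rh) = 1 / 400 * (d * T / Rh) := by
        field_simp
        norm_num
      rw [e]
      linarith
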